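/- Let $X$ be a complex manifold on which a (discrete) group $G$ acts by holomorphic diffeomorphisms, and let $\mathcal U=(V_a)_{a\in I}$ be a $G$-invariant open covering of $X$, i.e. $G$ acts on $I$ and $V_{ga}=gV_a$ for all $g\in G$, $a\in I$. A *$G$-equivariant holomorphic gerbe* on $X$ (with respect to $\mathcal U$) consists of holomorphic line bundles $L_{a,b}$ on $V_a\cap V_b$ and $L_a(g)$ on $V_a$ ($a,b\in I$, $g\in G$), where $L_{a,a}$ is identified with the trivial bundle and $L_{b,a}$ with the dual of $L_{a,b}$, together with isomorphisms of holomorphic line bundles $$\phi_{a,b,c}\colon L_{a,c}\to L_{a,b}\otimes L_{b,c}\quad\text{on } V_a\cap V_b\cap V_c,$$ $$\phi_{a,b}(g)\colon (g^{-1})^*L_{g^{-1}a,g^{-1}b}\otimes L_b(g)\to L_a(g)\otimes L_{a,b}\quad\text{on } V_a\cap V_b,$$ $$\phi_a(g,h)\colon L_a(gh)\to L_a(g)\otimes (g^{-1})^*L_{g^{-1}a}(h)\quad\text{on } V_a,$$ such that $\phi_{a,b,c}$, viewed as an invertible section of $L_{a,b}\otimes L_{b,c}\otimes L_{c,a}$,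 is skew-symmetric in $a,b,c$ (a transposition of the indices replaces it by its inverse), and such that the following diagrams commute: the two maps $L_{a,d}\to L_{a,b}\otimes L_{b,c}\otimes L_{c,d}$ built from the $\phi_{\cdot,\cdot,\cdot}$ agree on fourfold intersections; the two maps $(g^{-1})^*L_{g^{-1}a,g^{-1}c}\otimes L_c(g)\to L_a(g)\otimes L_{a,b}\otimes L_{b,c}$ agree; the two maps $((gh)^{-1})^*L_{(gh)^{-1}a,(gh)^{-1}b}\otimes L_b(gh)\to L_a(g)\otimes (g^{-1})^*L_{g^{-1}a}(h)\otimes L_{a,b}$ agree; and the two maps $L_a(ghk)\to L_a(g)\otimes (g^{-1})^*L_{g^{-1}a}(h)\otimes((gh)^{-1})^*L_{(gh)^{-1}a}(k)$ agree. An *equivariant hermitian structure* on such a gerbe consists of smooth hermitian metrics on all the line bundles $L_{a,b}$ and $L_a(g)$ such that all the maps $\phi_{a,b,c}$, $\phi_{a,b}(g)$, $\phi_a(g,h)$ are unitary. A *connective structure* consists of smooth complex connections $\nabla_{a,b}$ on $L_{a,b}$ and $\nabla_{a;g}$ on $L_a(g)$ that are compatible with all the maps $\phi_{a,b,c}$,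 $\phi_{a,b}(g)$, $\phi_a(g,h)$ (for the induced connections on pullbacks and tensor products; for instance $\phi_{a,b,c}\circ\nabla_{a,c}=(\nabla_{a,b}\otimes\mathrm{id}+\mathrm{id}\otimes\nabla_{b,c})\circ\phi_{a,b,c}$). It is *compatible* if all the connections $\nabla_{a,b}$, $\nabla_{a;g}$ preserve the hermitian metrics and are compatible with the holomorphic structures (i.e. $\nabla s$ is of type $(1,0)$ for every local holomorphic section $s$). **Theorem.** Every $G$-equivariant holomorphic gerbe with an equivariant hermitian structure possesses a unique compatible connective structure. -/

import Mathlib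

open Bundle Filter Topology TopologicalSpace
open scoped Manifold ContDiff TensorProduct

noncomputable section

universe u v w v₁ v₂ v₃ v₄ w₁ w₂ w₃ w₄

namespace HermGerbe

section Manifold

variable {E : Type u} [NormedAddCommGroup E] [NormedSpace ℂ E]
  {M : Type v} [TopologicalSpace M] [ChartedSpace E M]

/-- A complex manifold is, with the same charts, a smooth real manifold. -/
instance isManifold_real [hM : IsManifold 𝓘(ℂ, E) ω M] : IsManifold 𝓘(ℝ, E) ∞ M := by
  apply isManifold_of_contDiffOn
  intro e e' he he'
  have h := (contDiffGroupoid ω 𝓘(ℂ, E)).compatible he he'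
  rw [contDiffGroupoid, mem_groupoid_of_pregroupoid] at h
  have h2 : ContDiffOn ℂ ω _ _ := h.1
  exact (h2.restrict_scalars ℝ).of_le le_top

/-- The complex structure of the tangent space: multiplication by `i` (in any holomorphic chart;
here, in the preferred chart at `x`, through which Mathlib identifies the tangent space at `x`
with the model space). -/
def tangentI {x : M} (X : TangentSpace 𝓘(ℝ, E) x) : TangentSpace 𝓘(ℝ, E) x :=
  (fun Y : E ↦ Complex.I • Y) X

end Manifold

/-- A holomorphic line bundle on the complex manifold `M`: a holomorphic vector bundle with model
fibre `ℂ`. -/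
structure HolLineBundle (E : Type u) [NormedAddCommGroup E] [NormedSpace ℂ E]
    (M : Type v) [TopologicalSpace M] [ChartedSpace E M] where
  /-- the fibres -/
  Fiber : M → Type w
  [addCommGroup : ∀ x, AddCommGroup (Fiber x)]
  [module : ∀ x, Module ℂ (Fiber x)]
  [topFiber : ∀ x, TopologicalSpace (Fiber x)]
  [topAddGroup : ∀ x, IsTopologicalAddGroup (Fiber x)]
  [contSMul : ∀ x, ContinuousSMul ℂ (Fiber x)]
  [topTotal : TopologicalSpace (TotalSpace ℂ Fiber)]
  [fiberBundle : FiberBundle ℂ Fiber]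
  [vectorBundle : VectorBundle ℂ ℂ Fiber]
  [holomorphic : ContMDiffVectorBundle ω ℂ Fiber 𝓘(ℂ, E)]

attribute [instance] HolLineBundle.addCommGroup HolLineBundle.module HolLineBundle.topFiber
  HolLineBundle.topAddGroup HolLineBundle.contSMul HolLineBundle.topTotal
  HolLineBundle.fiberBundle HolLineBundle.vectorBundle HolLineBundle.holomorphic

namespace HolLineBundle

variable {E : Type u} [NormedAddCommGroup E] [NormedSpace ℂ E]
  {M : Type v} [TopologicalSpace M] [ChartedSpace E M]
  (L : HolLineBundle.{u, v, w} E M)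

instance contSMulReal (x : M) : ContinuousSMul ℝ (L.Fiber x) :=
  IsScalarTower.continuousSMul ℂ

/-- The real vector bundle (with fibre the real plane `ℂ`) underlying a holomorphic line bundle. -/
instance vectorBundleReal : VectorBundle ℝ ℂ L.Fiber where
  trivialization_linear' e he := ⟨fun b hb ↦
    { map_add := (e.linear ℂ hb).map_add
      map_smul := fun c y ↦ by
        have h := (e.linear ℂ hb).map_smul (c : ℂ) y
        simpa using h }⟩
  continuousOn_coordChange' e e' he he' := by
    have h := VectorBundle.continuousOn_coordChange' (R := ℂ) e e'
    refine ((ContinuousLinearMap.restrictScalarsL ℂ ℂ ℂ ℝ ℝ).continuous.comp_continuousOn h).congr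
      fun b hb ↦ ?_
    ext1
    simp [Trivialization.coordChangeL_apply _ _ hb]

/-- The section `s` of `L` is differentiable, in the real sense, at `x`. -/
def DiffAt (s : ∀ y, L.Fiber y) (x : M) : Prop :=
  MDifferentiableAt 𝓘(ℝ, E) (𝓘(ℝ, E).prod 𝓘(ℝ, ℂ)) (fun y ↦ TotalSpace.mk' ℂ y (s y)) x

/-- The section `s` of `L` is smooth (real `C^∞`) on `W`. -/
def SmoothOn (s : ∀ y, L.Fiber y) (W : Set M) : Prop :=
  ContMDiffOn 𝓘(ℝ, E) (𝓘(ℝ, E).prod 𝓘(ℝ, ℂ)) ∞ (fun y ↦ TotalSpace.mk' ℂ y (s y)) W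

/-- For a map `p : N → M` of complex manifolds, the section `s` of the pulled back bundle `p^* L` is
holomorphic near `x`. (A function is analytic at a point iff it is holomorphic near it.) -/
def HolAlong {N : Type v₁} [TopologicalSpace N] [ChartedSpace E N] (p : N → M)
    (s : ∀ y, L.Fiber (p y)) (x : N) : Prop :=
  ContMDiffAt 𝓘(ℂ, E) (𝓘(ℂ, E).prod 𝓘(ℂ, ℂ)) ω (fun y ↦ TotalSpace.mk' ℂ (p y) (s y)) x

/-- The section `s` of `L` is holomorphic near `x`. -/
def HolAt (s : ∀ y, L.Fiber y) (x : M) : Prop := L.HolAlong (fun y ↦ y) s x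

end HolLineBundle

section Isomorphisms

variable {E : Type u} [NormedAddCommGroup E] [NormedSpace ℂ E]
  {N : Type v} [TopologicalSpace N] [ChartedSpace E N]
  {M₁ : Type v₁} [TopologicalSpace M₁] [ChartedSpace E M₁]
  {M₂ : Type v₂} [TopologicalSpace M₂] [ChartedSpace E M₂]
  {M₃ : Type v₃} [TopologicalSpace M₃] [ChartedSpace E M₃]
  {M₄ : Type v₄} [TopologicalSpace M₄] [ChartedSpace E M₄]

/-- A holomorphic isomorphism `p^* A → q^* B ⊗ r^* C` of line bundles on `N`. Holomorphic sections
of a tensor product of two line bundles are those that are locally of the form `s ⊗ t`, with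
holomorphic `s` and `t`. -/
structure TensorIso (p : N → M₁) (A : HolLineBundle.{u, v₁, w₁} E M₁)
    (q : N → M₂) (B : HolLineBundle.{u, v₂, w₂} E M₂)
    (r : N → M₃) (C : HolLineBundle.{u, v₃, w₃} E M₃) where
  /-- the isomorphisms of the fibres -/
  equiv : ∀ x : N, A.Fiber (p x) ≃ₗ[ℂ] B.Fiber (q x) ⊗[ℂ] C.Fiber (r x)
  holomorphic : ∀ (x : N) (u : ∀ y, A.Fiber (p y)), A.HolAlong p u x →
    ∃ (s : ∀ y, B.Fiber (q y)) (t : ∀ y, C.Fiber (r y)), B.HolAlong q s x ∧ C.HolAlong r t x ∧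
      ∀ᶠ y in 𝓝 x, equiv y (u y) = s y ⊗ₜ[ℂ] t y

/-- A holomorphic isomorphism `p^* A ⊗ q^* B → r^* C ⊗ t^* D` of line bundles on `N`. -/
structure TensorIso₂ (p : N → M₁) (A : HolLineBundle.{u, v₁, w₁} E M₁)
    (q : N → M₂) (B : HolLineBundle.{u, v₂, w₂} E M₂)
    (r : N → M₃) (C : HolLineBundle.{u, v₃, w₃} E M₃)
    (t : N → M₄) (D : HolLineBundle.{u, v₄, w₄} E M₄) where
  /-- the isomorphisms of the fibres -/
  equiv : ∀ x : N, A.Fiber (p x) ⊗[ℂ] B.Fiber (q x) ≃ₗ[ℂ] C.Fiber (r x) ⊗[ℂ] D.Fiber (t x)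
  holomorphic : ∀ (x : N) (a : ∀ y, A.Fiber (p y)) (b : ∀ y, B.Fiber (q y)),
    A.HolAlong p a x → B.HolAlong q b x →
    ∃ (c : ∀ y, C.Fiber (r y)) (d : ∀ y, D.Fiber (t y)), C.HolAlong r c x ∧ D.HolAlong t d x ∧
      ∀ᶠ y in 𝓝 x, equiv y (a y ⊗ₜ[ℂ] b y) = c y ⊗ₜ[ℂ] d y

/-- A holomorphic trivialisation `A → N × ℂ`. -/
structure TrivIso (A : HolLineBundle.{u, v, w₁} E N) where
  /-- the isomorphisms of the fibres -/
  equiv : ∀ x : N, A.Fiber x ≃ₗ[ℂ] ℂ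
  holomorphic : ∀ (x : N) (u : ∀ y, A.Fiber y), A.HolAt u x →
    ContMDiffAt 𝓘(ℂ, E) 𝓘(ℂ, ℂ) ω (fun y ↦ equiv y (u y)) x

/-- A holomorphic isomorphism `A ⊗ q^* B → N × ℂ`, identifying `A` with the dual of `q^* B`. -/
structure DualIso (A : HolLineBundle.{u, v, w₁} E N)
    (q : N → M₂) (B : HolLineBundle.{u, v₂, w₂} E M₂) where
  /-- the isomorphisms of the fibres -/
  equiv : ∀ x : N, A.Fiber x ⊗[ℂ] B.Fiber (q x) ≃ₗ[ℂ] ℂ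
  holomorphic : ∀ (x : N) (a : ∀ y, A.Fiber y) (b : ∀ y, B.Fiber (q y)),
    A.HolAt a x → B.HolAlong q b x →
    ContMDiffAt 𝓘(ℂ, E) 𝓘(ℂ, ℂ) ω (fun y ↦ equiv y (a y ⊗ₜ[ℂ] b y)) x

end Isomorphisms

section Hermitian

variable {E : Type u} [NormedAddCommGroup E] [NormedSpace ℂ E]
  {N : Type v} [TopologicalSpace N] [ChartedSpace E N]
  {M₁ : Type v₁} [TopologicalSpace M₁] [ChartedSpace E M₁]
  {M₂ : Type v₂} [TopologicalSpace M₂] [ChartedSpace E M₂]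
  {M₃ : Type v₃} [TopologicalSpace M₃] [ChartedSpace E M₃]
  {M₄ : Type v₄} [TopologicalSpace M₄] [ChartedSpace E M₄]

/-- A smooth hermitian metric on the fibres of a line bundle (antilinear in the first argument). -/
@[ext]
structure HermitianMetric (L : HolLineBundle.{u, v, w} E N) where
  /-- the hermitian forms on the fibres -/
  form : ∀ x, L.Fiber x →ₗ⋆[ℂ] L.Fiber x →ₗ[ℂ] ℂ
  conj_symm : ∀ x a b, starRingEnd ℂ (form x a b) = form x b a
  pos : ∀ x a, a ≠ 0 → 0 < (form x a a).re
  smooth : ∀ (W : Set N), IsOpen W → ∀ s t : ∀ y, L.Fiber y, L.SmoothOn s W → L.SmoothOn t W →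
    ContMDiffOn 𝓘(ℝ, E) 𝓘(ℝ, ℂ) ∞ (fun y ↦ form y (s y) (t y)) W

/-- The sesquilinear form on a tensor product with
`⟨b ⊗ c, b' ⊗ c'⟩ = ⟨b, b'⟩ ⟨c, c'⟩`. -/
def tensorForm {B : Type*} [AddCommGroup B] [Module ℂ B] {C : Type*} [AddCommGroup C] [Module ℂ C]
    (h : B →ₗ⋆[ℂ] B →ₗ[ℂ] ℂ) (k : C →ₗ⋆[ℂ] C →ₗ[ℂ] ℂ) (x y : B ⊗[ℂ] C) : ℂ :=
  ((TensorProduct.lift <| TensorProduct.mapBilinear (.id ℂ) B C ℂ ℂ).compr₂ (.mul' ℂ ℂ) ∘ₛₗ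
    TensorProduct.map h k) x y

@[simp]
theorem tensorForm_tmul {B : Type*} [AddCommGroup B] [Module ℂ B]
    {C : Type*} [AddCommGroup C] [Module ℂ C]
    (h : B →ₗ⋆[ℂ] B →ₗ[ℂ] ℂ) (k : C →ₗ⋆[ℂ] C →ₗ[ℂ] ℂ) (b b' : B) (c c' : C) :
    tensorForm h k (b ⊗ₜ c) (b' ⊗ₜ c') = h b b' * k c c' := rfl

/-- The isomorphism `p^* A → q^* B ⊗ r^* C` is unitary. -/
def TensorIso.IsUnitary {p : N → M₁} {A : HolLineBundle.{u, v₁, w₁} E M₁}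
    {q : N → M₂} {B : HolLineBundle.{u, v₂, w₂} E M₂}
    {r : N → M₃} {C : HolLineBundle.{u, v₃, w₃} E M₃} (φ : TensorIso p A q B r C)
    (hA : HermitianMetric A) (hB : HermitianMetric B) (hC : HermitianMetric C) : Prop :=
  ∀ (x : N) (a a' : A.Fiber (p x)),
    tensorForm (hB.form (q x)) (hC.form (r x)) (φ.equiv x a) (φ.equiv x a') = hA.form (p x) a a'

/-- The isomorphism `p^* A ⊗ q^* B → r^* C ⊗ t^* D` is unitary. -/
def TensorIso₂.IsUnitary {p : N → M₁} {A : HolLineBundle.{u, v₁, w₁} E M₁}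
    {q : N → M₂} {B : HolLineBundle.{u, v₂, w₂} E M₂}
    {r : N → M₃} {C : HolLineBundle.{u, v₃, w₃} E M₃}
    {t : N → M₄} {D : HolLineBundle.{u, v₄, w₄} E M₄} (φ : TensorIso₂ p A q B r C t D)
    (hA : HermitianMetric A) (hB : HermitianMetric B) (hC : HermitianMetric C)
    (hD : HermitianMetric D) : Prop :=
  ∀ (x : N) (z z' : A.Fiber (p x) ⊗[ℂ] B.Fiber (q x)),
    tensorForm (hC.form (r x)) (hD.form (t x)) (φ.equiv x z) (φ.equiv x z') =
      tensorForm (hA.form (p x)) (hB.form (q x)) z z'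

/-- A smooth complex connection on a line bundle: a covariant derivative that satisfies the Leibniz
rule for complex functions and maps smooth local sections to smooth bundle-valued 1-forms.
`toFun s x X` is `∇_X s` at `x`. As a covariant derivative in Mathlib is
a function of all set-theoretic sections, the (meaningless) values at sections that are
not differentiable at the point are normalised to be zero, so that two connections are equal iff
they agree on all sections that can be differentiated. -/
@[ext]
structure Connection [IsManifold 𝓘(ℂ, E) ω N] (L : HolLineBundle.{u, v, w} E N) extends
    CovariantDerivative 𝓘(ℝ, E) ℂ L.Fiber where
  complex_leibniz : ∀ (s : ∀ y, L.Fiber y) (f : N → ℂ) (x : N) (X : TangentSpace 𝓘(ℝ, E) x),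
    L.DiffAt s x → MDifferentiableAt 𝓘(ℝ, E) 𝓘(ℝ, ℂ) f x →
    toFun (fun y ↦ f y • s y) x X = f x • toFun s x X + mvfderiv 𝓘(ℝ, E) f x X • s x
  smooth : ∀ W : Set N, IsOpen W → ContMDiffCovariantDerivativeOn ℂ ∞ toFun W
  eq_zero_of_not_diffAt : ∀ (s : ∀ y, L.Fiber y) (x : N), ¬ L.DiffAt s x → toFun s x = 0

namespace Connection

variable [IsManifold 𝓘(ℂ, E) ω N] {L : HolLineBundle.{u, v, w} E N}

/-- The connection preserves the hermitian metric: `d⟨s, t⟩ = ⟨∇s, t⟩ + ⟨s, ∇t⟩`. -/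
def PreservesMetric (D : Connection L) (h : HermitianMetric L) : Prop :=
  ∀ (s t : ∀ y, L.Fiber y) (x : N) (X : TangentSpace 𝓘(ℝ, E) x), L.DiffAt s x → L.DiffAt t x →
    mvfderiv 𝓘(ℝ, E) (fun y ↦ h.form y (s y) (t y)) x X =
      h.form x (D.toFun s x X) (t x) + h.form x (s x) (D.toFun t x X)

/-- The connection is compatible with the holomorphic structure: its `(0,1)`-part annihilates the
holomorphic sections, i.e. `∇s` is of type `(1,0)` for every local holomorphic section `s`. -/
def IsHolCompatible (D : Connection L) : Prop :=
  ∀ (s : ∀ y, L.Fiber y) (x : N) (X : TangentSpace 𝓘(ℝ, E) x), L.HolAt s x →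
    D.toFun s x (tangentI X) = Complex.I • D.toFun s x X

end Connection

variable [IsManifold 𝓘(ℂ, E) ω M₁] [IsManifold 𝓘(ℂ, E) ω M₂] [IsManifold 𝓘(ℂ, E) ω M₃]
  [IsManifold 𝓘(ℂ, E) ω M₄]

/-- The isomorphism `φ : p^* A → q^* B ⊗ r^* C` (with `p`, `q`, `r` local isomorphisms of complex
manifolds) is compatible with the connections: `φ ∘ ∇ = (∇ ⊗ id + id ⊗ ∇) ∘ φ`. Here a local section
of a pullback is a pullback of a local section, for which `(p^* ∇)_X (p^* s) = ∇_{dp X} s`. -/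
def TensorIso.IsParallel {p : N → M₁} {A : HolLineBundle.{u, v₁, w₁} E M₁}
    {q : N → M₂} {B : HolLineBundle.{u, v₂, w₂} E M₂}
    {r : N → M₃} {C : HolLineBundle.{u, v₃, w₃} E M₃} (φ : TensorIso p A q B r C)
    (DA : Connection A) (DB : Connection B) (DC : Connection C) : Prop :=
  ∀ (x : N) (a : ∀ y, A.Fiber y) (b : ∀ y, B.Fiber y) (c : ∀ y, C.Fiber y),
    A.DiffAt a (p x) → B.DiffAt b (q x) → C.DiffAt c (r x) →
    (∀ᶠ y in 𝓝 x, φ.equiv y (a (p y)) = b (q y) ⊗ₜ[ℂ] c (r y)) →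
    ∀ X : TangentSpace 𝓘(ℝ, E) x,
      φ.equiv x (DA.toFun a (p x) (mfderiv 𝓘(ℝ, E) 𝓘(ℝ, E) p x X)) =
        DB.toFun b (q x) (mfderiv 𝓘(ℝ, E) 𝓘(ℝ, E) q x X) ⊗ₜ[ℂ] c (r x) +
          b (q x) ⊗ₜ[ℂ] DC.toFun c (r x) (mfderiv 𝓘(ℝ, E) 𝓘(ℝ, E) r x X)

/-- The isomorphism `φ : p^* A ⊗ q^* B → r^* C ⊗ t^* D` (with `p`, `q`, `r`, `t` local isomorphisms
of complex manifolds) is compatible with the connections: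
`φ ∘ (∇ ⊗ id + id ⊗ ∇) = (∇ ⊗ id + id ⊗ ∇) ∘ φ`. -/
def TensorIso₂.IsParallel {p : N → M₁} {A : HolLineBundle.{u, v₁, w₁} E M₁}
    {q : N → M₂} {B : HolLineBundle.{u, v₂, w₂} E M₂}
    {r : N → M₃} {C : HolLineBundle.{u, v₃, w₃} E M₃}
    {t : N → M₄} {D : HolLineBundle.{u, v₄, w₄} E M₄} (φ : TensorIso₂ p A q B r C t D)
    (DA : Connection A) (DB : Connection B) (DC : Connection C) (DD : Connection D) : Prop :=
  ∀ (x : N) (a : ∀ y, A.Fiber y) (b : ∀ y, B.Fiber y) (c : ∀ y, C.Fiber y) (d : ∀ y, D.Fiber y),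
    A.DiffAt a (p x) → B.DiffAt b (q x) → C.DiffAt c (r x) → D.DiffAt d (t x) →
    (∀ᶠ y in 𝓝 x, φ.equiv y (a (p y) ⊗ₜ[ℂ] b (q y)) = c (r y) ⊗ₜ[ℂ] d (t y)) →
    ∀ X : TangentSpace 𝓘(ℝ, E) x,
      φ.equiv x (DA.toFun a (p x) (mfderiv 𝓘(ℝ, E) 𝓘(ℝ, E) p x X) ⊗ₜ[ℂ] b (q x) +
          a (p x) ⊗ₜ[ℂ] DB.toFun b (q x) (mfderiv 𝓘(ℝ, E) 𝓘(ℝ, E) q x X)) =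
        DC.toFun c (r x) (mfderiv 𝓘(ℝ, E) 𝓘(ℝ, E) r x X) ⊗ₜ[ℂ] d (t x) +
          c (r x) ⊗ₜ[ℂ] DD.toFun d (t x) (mfderiv 𝓘(ℝ, E) 𝓘(ℝ, E) t x X)

end Hermitian

section Gerbe

variable (E : Type u) [NormedAddCommGroup E] [NormedSpace ℂ E]
  {X : Type v} [TopologicalSpace X] [ChartedSpace E X]
  {I : Type v₂}

/-- The inclusion of a triple intersection into the intersection of the first two sets. -/
def res₁₂ (V : I → Opens X) (a b c : I) (x : ↥(V a ⊓ V b ⊓ V c)) : ↥(V a ⊓ V b) :=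
  ⟨x.1, x.2.1⟩

/-- The inclusion of a triple intersection into the intersection of the last two sets. -/
def res₂₃ (V : I → Opens X) (a b c : I) (x : ↥(V a ⊓ V b ⊓ V c)) : ↥(V b ⊓ V c) :=
  ⟨x.1, x.2.1.2, x.2.2⟩

/-- The inclusion of a triple intersection into the intersection of the first and the last set. -/
def res₁₃ (V : I → Opens X) (a b c : I) (x : ↥(V a ⊓ V b ⊓ V c)) : ↥(V a ⊓ V c) :=
  ⟨x.1, x.2.1.1, x.2.2⟩

/-- The inclusion of an intersection into the first set. -/
def res₁ (V : I → Opens X) (a b : I) (x : ↥(V a ⊓ V b)) : ↥(V a) := ⟨x.1, x.2.1⟩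

/-- The inclusion of an intersection into the second set. -/
def res₂ (V : I → Opens X) (a b : I) (x : ↥(V a ⊓ V b)) : ↥(V b) := ⟨x.1, x.2.2⟩

/-- The identification of `V b ⊓ V a` with `V a ⊓ V b`. -/
def swapInter (V : I → Opens X) (a b : I) (x : ↥(V a ⊓ V b)) : ↥(V b ⊓ V a) := ⟨x.1, x.2.2, x.2.1⟩

/-- The transition bundles `L a b` on `V a ∩ V b` of a gerbe, with the structure maps
`φ a b c : L a c → L a b ⊗ L b c` on triple intersections and the identifications of `L a a` with
the trivial bundle and of `L b a` with the dual of `L a b`. -/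
structure GerbeData (V : I → Opens X) where
  /-- the transition bundles -/
  L : ∀ a b, HolLineBundle.{u, v, w} E ↥(V a ⊓ V b)
  /-- the structure maps -/
  φ : ∀ a b c, TensorIso (res₁₃ V a b c) (L a c) (res₁₂ V a b c) (L a b) (res₂₃ V a b c) (L b c)
  /-- `L a a` is trivial -/
  triv : ∀ a, TrivIso (L a a)
  /-- `L b a` is dual to `L a b` -/
  dual : ∀ a b, DualIso (L a b) (swapInter V a b) (L b a)

namespace GerbeData

variable {E} {V : I → Opens X} (𝒢 : GerbeData.{u, v, w} E V)

/-- The fibre of `L a b` at a point of `X`. -/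
abbrev LAt (a b : I) (x : X) (ha : x ∈ V a) (hb : x ∈ V b) : Type w := (𝒢.L a b).Fiber ⟨x, ha, hb⟩

/-- The structure map `φ a b c` at a point of `X`. -/
def φAt (a b c : I) (x : X) (ha : x ∈ V a) (hb : x ∈ V b) (hc : x ∈ V c) :
    𝒢.LAt a c x ha hc ≃ₗ[ℂ] 𝒢.LAt a b x ha hb ⊗[ℂ] 𝒢.LAt b c x hb hc :=
  (𝒢.φ a b c).equiv ⟨x, ⟨ha, hb⟩, hc⟩

/-- The trivialisation of `L a a` at a point of `X`. -/
def trivAt (a : I) (x : X) (ha : x ∈ V a) : 𝒢.LAt a a x ha ha ≃ₗ[ℂ] ℂ :=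
  (𝒢.triv a).equiv ⟨x, ha, ha⟩

/-- The duality pairing of `L a b` and `L b a` at a point of `X`. -/
def dualAt (a b : I) (x : X) (ha : x ∈ V a) (hb : x ∈ V b) :
    𝒢.LAt a b x ha hb ⊗[ℂ] 𝒢.LAt b a x hb ha ≃ₗ[ℂ] ℂ :=
  (𝒢.dual a b).equiv ⟨x, ha, hb⟩

end GerbeData

/-- A holomorphic gerbe, given by transition bundles with respect to the open sets `V a`. -/
structure HolGerbe (V : I → Opens X) extends GerbeData.{u, v, w} E V where
  /-- coassociativity: `(φ_{abc} ⊗ id) ∘ φ_{acd} = (id ⊗ φ_{bcd}) ∘ φ_{abd}` -/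
  coassoc : ∀ (a b c d : I) (x : X) (ha : x ∈ V a) (hb : x ∈ V b) (hc : x ∈ V c) (hd : x ∈ V d)
    (l : toGerbeData.LAt a d x ha hd),
    TensorProduct.assoc ℂ _ _ _ (TensorProduct.map (toGerbeData.φAt a b c x ha hb hc).toLinearMap
      LinearMap.id (toGerbeData.φAt a c d x ha hc hd l)) =
    TensorProduct.map LinearMap.id (toGerbeData.φAt b c d x hb hc hd).toLinearMap
      (toGerbeData.φAt a b d x ha hb hd l)
  /-- the duality pairings of `L a b` with `L b a` and of `L b a` with `L a b` are the same -/
  dual_symm : ∀ (a b : I) (x : X) (ha : x ∈ V a) (hb : x ∈ V b)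
    (l : toGerbeData.LAt a b x ha hb) (l' : toGerbeData.LAt b a x hb ha),
    toGerbeData.dualAt a b x ha hb (l ⊗ₜ l') = toGerbeData.dualAt b a x hb ha (l' ⊗ₜ l)
  /-- the trivial bundle `L a a` is dual to itself in the obvious way -/
  dual_self : ∀ (a : I) (x : X) (ha : x ∈ V a) (l l' : toGerbeData.LAt a a x ha ha),
    toGerbeData.dualAt a a x ha ha (l ⊗ₜ l') =
      toGerbeData.trivAt a x ha l * toGerbeData.trivAt a x ha l'
  /-- skew-symmetry of `φ` in the first two indices: the contraction of `φ_{abc}` and `φ_{bac}`,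
  viewed as sections of `L a b ⊗ L b c ⊗ L c a` and `L b a ⊗ L a c ⊗ L c b`, is one; that is,
  `L a c → L a b ⊗ L b c → L a b ⊗ (L b a ⊗ L a c) → L a c` is the identity. -/
  skew₁₂ : ∀ (a b c : I) (x : X) (ha : x ∈ V a) (hb : x ∈ V b) (hc : x ∈ V c)
    (l : toGerbeData.LAt a c x ha hc),
    TensorProduct.lid ℂ _ (TensorProduct.map (toGerbeData.dualAt a b x ha hb).toLinearMap
      LinearMap.id ((TensorProduct.assoc ℂ _ _ _).symm
        (TensorProduct.map LinearMap.id (toGerbeData.φAt b a c x hb ha hc).toLinearMap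
          (toGerbeData.φAt a b c x ha hb hc l)))) = l
  /-- skew-symmetry of `φ` in the last two indices: the contraction of `φ_{abc}` and `φ_{acb}`,
  viewed as sections of `L a b ⊗ L b c ⊗ L c a` and `L a c ⊗ L c b ⊗ L b a`, is one; that is,
  `L a c → L a b ⊗ L b c → (L a c ⊗ L c b) ⊗ L b c → L a c` is the identity. -/
  skew₂₃ : ∀ (a b c : I) (x : X) (ha : x ∈ V a) (hb : x ∈ V b) (hc : x ∈ V c)
    (l : toGerbeData.LAt a c x ha hc),
    TensorProduct.rid ℂ _ (TensorProduct.map LinearMap.id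
      (toGerbeData.dualAt c b x hc hb).toLinearMap (TensorProduct.assoc ℂ _ _ _
        (TensorProduct.map (toGerbeData.φAt a c b x ha hc hb).toLinearMap LinearMap.id
          (toGerbeData.φAt a b c x ha hb hc l)))) = l

end Gerbe

section Cover

variable {G : Type v₁} [Group G] {X : Type v} [TopologicalSpace X] [MulAction G X]
  {I : Type v₂} [MulAction G I]

variable (G X I) in
/-- A `G`-invariant open covering of `X`: the group acts on the index set `I` such that
`V (g a) = g V a`. -/
structure InvariantCover where
  /-- the open sets -/
  V : I → Opens X
  covers : ∀ x, ∃ a, x ∈ V a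
  smul_eq : ∀ (g : G) (a : I), (V (g • a) : Set X) = (fun x ↦ g • x) '' (V a : Set X)

theorem InvariantCover.inv_mem (𝒰 : InvariantCover G X I) (g : G) {a : I} {x : X}
    (hx : x ∈ 𝒰.V a) : g⁻¹ • x ∈ 𝒰.V (g⁻¹ • a) := by
  have h : g⁻¹ • x ∈ (𝒰.V (g⁻¹ • a) : Set X) := 𝒰.smul_eq g⁻¹ a ▸ ⟨x, hx, rfl⟩
  exact h

/-- The map `V a → V (g⁻¹ a)`, `x ↦ g⁻¹ x`. -/
def translate (𝒰 : InvariantCover G X I) (g : G) (a : I) (x : ↥(𝒰.V a)) : ↥(𝒰.V (g⁻¹ • a)) :=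
  ⟨g⁻¹ • x.1, 𝒰.inv_mem g x.2⟩

/-- The map `V a ∩ V b → V (g⁻¹ a) ∩ V (g⁻¹ b)`, `x ↦ g⁻¹ x`. -/
def translate₂ (𝒰 : InvariantCover G X I) (g : G) (a b : I) (x : ↥(𝒰.V a ⊓ 𝒰.V b)) :
    ↥(𝒰.V (g⁻¹ • a) ⊓ 𝒰.V (g⁻¹ • b)) :=
  ⟨g⁻¹ • x.1, 𝒰.inv_mem g x.2.1, 𝒰.inv_mem g x.2.2⟩

end Cover

section EquivariantGerbe

variable (E : Type u) [NormedAddCommGroup E] [NormedSpace ℂ E]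
  {G : Type v₁} [Group G] {X : Type v} [TopologicalSpace X] [ChartedSpace E X] [MulAction G X]
  {I : Type v₂} [MulAction G I]

/-- A holomorphic gerbe with the additional line bundles `Lg g a` (written `L_a(g)`) on `V a` and
structure maps
`φ₁ g a b : (g⁻¹)^* L (g⁻¹ a) (g⁻¹ b) ⊗ Lg g b → Lg g a ⊗ L a b` on `V a ∩ V b`,
`φ₂ g h a : Lg (g h) a → Lg g a ⊗ (g⁻¹)^* Lg h (g⁻¹ a)` on `V a`. -/
structure EquivariantGerbeData (𝒰 : InvariantCover G X I) extends HolGerbe.{u, v, w} E 𝒰.V where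
  /-- the line bundles `L_a(g)` -/
  Lg : G → ∀ a : I, HolLineBundle.{u, v, w} E ↥(𝒰.V a)
  /-- the structure maps `φ_{a,b}(g)` -/
  φ₁ : ∀ (g : G) (a b : I),
    TensorIso₂ (translate₂ 𝒰 g a b) (L (g⁻¹ • a) (g⁻¹ • b)) (res₂ 𝒰.V a b) (Lg g b)
      (res₁ 𝒰.V a b) (Lg g a) id (L a b)
  /-- the structure maps `φ_a(g,h)` -/
  φ₂ : ∀ (g h : G) (a : I),
    TensorIso id (Lg (g * h) a) id (Lg g a) (translate 𝒰 g a) (Lg h (g⁻¹ • a))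

namespace EquivariantGerbeData

variable {E} {𝒰 : InvariantCover G X I} (𝒢 : EquivariantGerbeData.{u, v, w} E 𝒰)

/-- The fibre of `Lg g a` at a point of `X`. -/
abbrev LgAt (g : G) (a : I) (x : X) (ha : x ∈ 𝒰.V a) : Type w := (𝒢.Lg g a).Fiber ⟨x, ha⟩

/-- The structure map `φ_{a,b}(g)` at a point of `X`. -/
def φ₁At (g : G) (a b : I) (x : X) (ha : x ∈ 𝒰.V a) (hb : x ∈ 𝒰.V b) :
    𝒢.LAt (g⁻¹ • a) (g⁻¹ • b) (g⁻¹ • x) (𝒰.inv_mem g ha) (𝒰.inv_mem g hb) ⊗[ℂ] 𝒢.LgAt g b x hb ≃ₗ[ℂ]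
      𝒢.LgAt g a x ha ⊗[ℂ] 𝒢.LAt a b x ha hb :=
  (𝒢.φ₁ g a b).equiv ⟨x, ha, hb⟩

/-- The structure map `φ_a(g,h)` at a point of `X`. -/
def φ₂At (g h : G) (a : I) (x : X) (ha : x ∈ 𝒰.V a) :
    𝒢.LgAt (g * h) a x ha ≃ₗ[ℂ]
      𝒢.LgAt g a x ha ⊗[ℂ] 𝒢.LgAt h (g⁻¹ • a) (g⁻¹ • x) (𝒰.inv_mem g ha) :=
  (𝒢.φ₂ g h a).equiv ⟨x, ha⟩

/-- The identity map between two fibres with equal indices. -/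
def castL {a a' b b' : I} {x x' : X} (h₁ : a = a') (h₂ : b = b') (h₃ : x = x')
    (ha : x ∈ 𝒰.V a) (hb : x ∈ 𝒰.V b) (ha' : x' ∈ 𝒰.V a') (hb' : x' ∈ 𝒰.V b') :
    𝒢.LAt a b x ha hb ≃ₗ[ℂ] 𝒢.LAt a' b' x' ha' hb' := by
  subst h₁ h₂ h₃
  exact LinearEquiv.refl ℂ _

/-- The identity map between two fibres with equal indices. -/
def castLg {g g' : G} {a a' : I} {x x' : X} (h₁ : g = g') (h₂ : a = a') (h₃ : x = x')
    (ha : x ∈ 𝒰.V a) (ha' : x' ∈ 𝒰.V a') :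
    𝒢.LgAt g a x ha ≃ₗ[ℂ] 𝒢.LgAt g' a' x' ha' := by
  subst h₁ h₂ h₃
  exact LinearEquiv.refl ℂ _

end EquivariantGerbeData

/-- A `G`-equivariant holomorphic gerbe: the structure maps obey the natural coherence conditions
(which, for trivial line bundles, are the 2-cocycle conditions of the group-Čech complex). -/
structure EquivariantGerbe (𝒰 : InvariantCover G X I) extends
    EquivariantGerbeData.{u, v, w} E 𝒰 where
  /-- The two maps `L_a(ghk) → L_a(g) ⊗ (g⁻¹)^* L_{g⁻¹a}(h) ⊗ ((gh)⁻¹)^* L_{(gh)⁻¹a}(k)`, through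
  `L_a(gh)` and through `L_{g⁻¹a}(hk)`, are equal. -/
  coherence₂₀ : ∀ (g h k : G) (a : I) (x : X) (ha : x ∈ 𝒰.V a)
    (l : toEquivariantGerbeData.LgAt (g * h * k) a x ha),
    TensorProduct.map LinearMap.id (TensorProduct.map LinearMap.id
      (toEquivariantGerbeData.castLg (g := k) rfl
        (by rw [mul_inv_rev, mul_smul]) (by rw [mul_inv_rev, mul_smul])
        (𝒰.inv_mem (g * h) ha) (𝒰.inv_mem h (𝒰.inv_mem g ha))).toLinearMap)
      (TensorProduct.assoc ℂ _ _ _ (TensorProduct.map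
        (toEquivariantGerbeData.φ₂At g h a x ha).toLinearMap LinearMap.id
        (toEquivariantGerbeData.φ₂At (g * h) k a x ha l))) =
    TensorProduct.map LinearMap.id
      (toEquivariantGerbeData.φ₂At h k (g⁻¹ • a) (g⁻¹ • x) (𝒰.inv_mem g ha)).toLinearMap
      (toEquivariantGerbeData.φ₂At g (h * k) a x ha
        (toEquivariantGerbeData.castLg (mul_assoc g h k) rfl rfl ha ha l))
  /-- The two maps `(g⁻¹)^* L_{g⁻¹a,g⁻¹c} ⊗ L_c(g) → L_a(g) ⊗ L_{a,b} ⊗ L_{b,c}`, given by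
  `φ_{a,c}(g)` and `φ_{a,b,c}` and by `φ_{g⁻¹a,g⁻¹b,g⁻¹c}`, `φ_{b,c}(g)` and `φ_{a,b}(g)`,
  are equal. -/
  coherence₀₂ : ∀ (g : G) (a b c : I) (x : X) (ha : x ∈ 𝒰.V a) (hb : x ∈ 𝒰.V b) (hc : x ∈ 𝒰.V c)
    (z : toEquivariantGerbeData.LAt (g⁻¹ • a) (g⁻¹ • c) (g⁻¹ • x)
      (𝒰.inv_mem g ha) (𝒰.inv_mem g hc) ⊗[ℂ] toEquivariantGerbeData.LgAt g c x hc),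
    TensorProduct.map LinearMap.id (toEquivariantGerbeData.φAt a b c x ha hb hc).toLinearMap
      (toEquivariantGerbeData.φ₁At g a c x ha hc z) =
    TensorProduct.assoc ℂ _ _ _
      (TensorProduct.map (toEquivariantGerbeData.φ₁At g a b x ha hb).toLinearMap LinearMap.id
        ((TensorProduct.assoc ℂ _ _ _).symm
          (TensorProduct.map LinearMap.id
            (toEquivariantGerbeData.φ₁At g b c x hb hc).toLinearMap
            (TensorProduct.assoc ℂ _ _ _
              (TensorProduct.map (toEquivariantGerbeData.φAt (g⁻¹ • a) (g⁻¹ • b) (g⁻¹ • c)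
                (g⁻¹ • x) (𝒰.inv_mem g ha) (𝒰.inv_mem g hb) (𝒰.inv_mem g hc)).toLinearMap
                LinearMap.id z)))))
  /-- The two maps
  `((gh)⁻¹)^* L_{(gh)⁻¹a,(gh)⁻¹b} ⊗ L_b(gh) → L_a(g) ⊗ (g⁻¹)^* L_{g⁻¹a}(h) ⊗ L_{a,b}`, given by
  `φ_{a,b}(gh)` and `φ_a(g,h)` and by `φ_b(g,h)`, `φ_{g⁻¹a,g⁻¹b}(h)` and `φ_{a,b}(g)`,
  are equal. -/
  coherence₁₁ : ∀ (g h : G) (a b : I) (x : X) (ha : x ∈ 𝒰.V a) (hb : x ∈ 𝒰.V b)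
    (z : toEquivariantGerbeData.LAt ((g * h)⁻¹ • a) ((g * h)⁻¹ • b) ((g * h)⁻¹ • x)
      (𝒰.inv_mem (g * h) ha) (𝒰.inv_mem (g * h) hb) ⊗[ℂ]
        toEquivariantGerbeData.LgAt (g * h) b x hb),
    TensorProduct.map (toEquivariantGerbeData.φ₂At g h a x ha).toLinearMap LinearMap.id
      (toEquivariantGerbeData.φ₁At (g * h) a b x ha hb z) =
    TensorProduct.map (TensorProduct.comm ℂ _ _).toLinearMap LinearMap.id
      ((TensorProduct.assoc ℂ _ _ _).symm
        (TensorProduct.map LinearMap.id (toEquivariantGerbeData.φ₁At g a b x ha hb).toLinearMap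
          (TensorProduct.assoc ℂ _ _ _
            (TensorProduct.map
              (toEquivariantGerbeData.φ₁At h (g⁻¹ • a) (g⁻¹ • b) (g⁻¹ • x)
                (𝒰.inv_mem g ha) (𝒰.inv_mem g hb)).toLinearMap LinearMap.id
              ((TensorProduct.assoc ℂ _ _ _).symm
                (TensorProduct.map
                  (toEquivariantGerbeData.castL (by rw [mul_inv_rev, mul_smul])
                    (by rw [mul_inv_rev, mul_smul]) (by rw [mul_inv_rev, mul_smul])
                    (𝒰.inv_mem (g * h) ha) (𝒰.inv_mem (g * h) hb)
                    (𝒰.inv_mem h (𝒰.inv_mem g ha)) (𝒰.inv_mem h (𝒰.inv_mem g hb))).toLinearMap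
                  ((TensorProduct.comm ℂ _ _).toLinearMap ∘ₗ
                    (toEquivariantGerbeData.φ₂At g h b x hb).toLinearMap) z))))))

variable {E}
variable {𝒰 : InvariantCover G X I}

/-- An equivariant hermitian structure on an equivariant holomorphic gerbe: hermitian metrics on the
line bundles `L_{a,b}` and `L_a(g)` such that the structure maps are unitary. -/
structure EquivariantHermitianStructure (𝒢 : EquivariantGerbe.{u, v, w} E 𝒰) where
  /-- the metrics on the transition bundles -/
  metric : ∀ a b, HermitianMetric (𝒢.L a b)
  /-- the metrics on the line bundles `L_a(g)` -/
  metricG : ∀ g a, HermitianMetric (𝒢.Lg g a)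
  unitary₀ : ∀ a b c, (𝒢.φ a b c).IsUnitary (metric a c) (metric a b) (metric b c)
  unitary₁ : ∀ g a b, (𝒢.φ₁ g a b).IsUnitary (metric (g⁻¹ • a) (g⁻¹ • b)) (metricG g b)
    (metricG g a) (metric a b)
  unitary₂ : ∀ g h a, (𝒢.φ₂ g h a).IsUnitary (metricG (g * h) a) (metricG g a)
    (metricG h (g⁻¹ • a))

/-- An (equivariant) connective structure on an equivariant holomorphic gerbe: smooth complex
connections on the line bundles `L_{a,b}` and `L_a(g)` that are compatible with the structure
maps. -/
structure ConnectiveStructure [IsManifold 𝓘(ℂ, E) ω X] (𝒢 : EquivariantGerbe.{u, v, w} E 𝒰) where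
  /-- the connections on the transition bundles -/
  conn : ∀ a b, Connection (𝒢.L a b)
  /-- the connections on the line bundles `L_a(g)` -/
  connG : ∀ g a, Connection (𝒢.Lg g a)
  parallel₀ : ∀ a b c, (𝒢.φ a b c).IsParallel (conn a c) (conn a b) (conn b c)
  parallel₁ : ∀ g a b, (𝒢.φ₁ g a b).IsParallel (conn (g⁻¹ • a) (g⁻¹ • b)) (connG g b)
    (connG g a) (conn a b)
  parallel₂ : ∀ g h a, (𝒢.φ₂ g h a).IsParallel (connG (g * h) a) (connG g a)
    (connG h (g⁻¹ • a))

/-- The connections of the connective structure preserve the hermitian structure and are compatible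
with the holomorphic structure. -/
structure ConnectiveStructure.IsCompatible [IsManifold 𝓘(ℂ, E) ω X]
    {𝒢 : EquivariantGerbe.{u, v, w} E 𝒰} (D : ConnectiveStructure 𝒢)
    (h : EquivariantHermitianStructure 𝒢) : Prop where
  preservesMetric : ∀ a b, (D.conn a b).PreservesMetric (h.metric a b)
  preservesMetricG : ∀ g a, (D.connG g a).PreservesMetric (h.metricG g a)
  holCompatible : ∀ a b, (D.conn a b).IsHolCompatible
  holCompatibleG : ∀ g a, (D.connG g a).IsHolCompatible

end EquivariantGerbe

end HermGerbe

namespace HermGerbe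

/-! ### Real derivatives, multiplication by `i`, and the form `∂ log H`. -/

section RealStructure

variable {E : Type u} [NormedAddCommGroup E] [NormedSpace ℂ E]
  {E' : Type*} [NormedAddCommGroup E'] [NormedSpace ℂ E']
  {M : Type v} [TopologicalSpace M] [ChartedSpace E M]
  {N : Type v₁} [TopologicalSpace N] [ChartedSpace E' N]

/-! Every bundle of the gerbe carries exactly one compatible connection, its Chern connection, and
these are automatically compatible with the structure maps.

For one hermitian line bundle with local holomorphic frame `e` and `H = ⟨e, e⟩`, put `∇e = θ e`.
Holomorphic compatibility says that `θ` has type `(1,0)`, and preservation of the metric says `dH =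
(θ + θ̄) H`. Together they force `θ = ∂ log H` (`IsChernDerivative.apply_frame`), and the Leibniz
rule then determines `∇` on all differentiable sections (`IsChernDerivative.apply`). Conversely,
this formula defines a connection (`isChernDerivative_chernDerivative`,
`contMDiffCovariantDerivativeOn_chernFun`). Uniqueness of the connective structure follows bundle by
bundle from `Connection.eq_chernConnection`.

For existence, a holomorphic isomorphism takes a frame to `k` times a frame, with `k` holomorphic
and nowhere zero. If it is also unitary, the square lengths of the frames differ by the factor
`|k|²`. Since `∂ log |k|² = dk / k`, the connection forms differ by exactly the change-of-frame term
(`chern_product_formula`). So unitary holomorphic isomorphisms are parallel for Chern connections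
(`TensorIso.IsUnitary.isParallel`, `TensorIso₂.IsUnitary.isParallel`). Pullbacks cause no trouble:
the inclusions and the translations by `g⁻¹` are holomorphic, and `∂` commutes with holomorphic
pullback (`logForm_comp`). -/

theorem contMDiffWithinAt_restrictScalars {f : M → N} {s : Set M} {x : M}
    (hf : ContMDiffWithinAt 𝓘(ℂ, E) 𝓘(ℂ, E') ω f s x) :
    ContMDiffWithinAt 𝓘(ℝ, E) 𝓘(ℝ, E') ∞ f s x := by
  rw [contMDiffWithinAt_iff] at hf ⊢
  exact ⟨hf.1, (ContDiffWithinAt.restrict_scalars ℝ hf.2).of_le le_top⟩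

theorem contMDiffAt_restrictScalars {f : M → N} {x : M}
    (hf : ContMDiffAt 𝓘(ℂ, E) 𝓘(ℂ, E') ω f x) : ContMDiffAt 𝓘(ℝ, E) 𝓘(ℝ, E') ∞ f x :=
  contMDiffWithinAt_restrictScalars hf

/-- The real derivative is the complex one with scalars restricted, hence it commutes with `i`:
these are the Cauchy–Riemann equations. -/
theorem mfderiv_tangentI {f : M → N} {x : M}
    (hf : MDifferentiableAt 𝓘(ℂ, E) 𝓘(ℂ, E') f x) (X : TangentSpace 𝓘(ℝ, E) x) :
    mfderiv 𝓘(ℝ, E) 𝓘(ℝ, E') f x (tangentI X) = tangentI (mfderiv 𝓘(ℝ, E) 𝓘(ℝ, E') f x X) := by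
  have h := hf.hasMFDerivAt
  let T : E →L[ℂ] E' := mfderiv 𝓘(ℂ, E) 𝓘(ℂ, E') f x
  have h' : HasMFDerivAt 𝓘(ℝ, E) 𝓘(ℝ, E') f x (T.restrictScalars ℝ) :=
    ⟨h.1, HasFDerivWithinAt.restrictScalars ℝ (f' := T) h.2⟩
  rw [h'.mfderiv]
  exact T.map_smul Complex.I X

theorem mvfderiv_tangentI {f : M → ℂ} {x : M}
    (hf : MDifferentiableAt 𝓘(ℂ, E) 𝓘(ℂ, ℂ) f x) (X : TangentSpace 𝓘(ℝ, E) x) :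
    mvfderiv 𝓘(ℝ, E) f x (tangentI X) = Complex.I * mvfderiv 𝓘(ℝ, E) f x X :=
  mfderiv_tangentI hf X

theorem tangentI_tangentI {x : M} (X : TangentSpace 𝓘(ℝ, E) x) : tangentI (tangentI X) = -X := by
  change Complex.I • Complex.I • (show E from X) = -(show E from X)
  rw [smul_smul, Complex.I_mul_I, neg_one_smul]

theorem mvfderiv_cmul {f g : M → ℂ} {x : M} (hf : MDifferentiableAt 𝓘(ℝ, E) 𝓘(ℝ, ℂ) f x)
    (hg : MDifferentiableAt 𝓘(ℝ, E) 𝓘(ℝ, ℂ) g x) (X : TangentSpace 𝓘(ℝ, E) x) :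
    mvfderiv 𝓘(ℝ, E) (fun y ↦ f y * g y) x X =
      f x * mvfderiv 𝓘(ℝ, E) g x X + mvfderiv 𝓘(ℝ, E) f x X * g x := by
  have h := (hf.hasMFDerivAt.mul' hg.hasMFDerivAt).mfderiv
  have h' : mvfderiv 𝓘(ℝ, E) (fun y ↦ f y * g y) x X =
    mfderiv 𝓘(ℝ, E) 𝓘(ℝ, ℂ) (f * g) x X := rfl
  rw [h', h]
  rfl

theorem mvfderiv_conj {f : M → ℂ} {x : M} (hf : MDifferentiableAt 𝓘(ℝ, E) 𝓘(ℝ, ℂ) f x)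
    (X : TangentSpace 𝓘(ℝ, E) x) :
    mvfderiv 𝓘(ℝ, E) (fun y ↦ starRingEnd ℂ (f y)) x X = starRingEnd ℂ (mvfderiv 𝓘(ℝ, E) f x X) := by
  have h := (Complex.conjCLE.toContinuousLinearMap.hasMFDerivAt (x := f x)).comp x hf.hasMFDerivAt
  exact congrArg (fun T : E →L[ℝ] ℂ ↦ T X) h.mfderiv

theorem mdifferentiableAt_conj {f : M → ℂ} {x : M} (hf : MDifferentiableAt 𝓘(ℝ, E) 𝓘(ℝ, ℂ) f x) :
    MDifferentiableAt 𝓘(ℝ, E) 𝓘(ℝ, ℂ) (fun y ↦ starRingEnd ℂ (f y)) x :=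
  ((Complex.conjCLE.toContinuousLinearMap.hasMFDerivAt (x := f x)).comp x
    hf.hasMFDerivAt).mdifferentiableAt

theorem mdifferentiableAt_cmul {f g : M → ℂ} {x : M} (hf : MDifferentiableAt 𝓘(ℝ, E) 𝓘(ℝ, ℂ) f x)
    (hg : MDifferentiableAt 𝓘(ℝ, E) 𝓘(ℝ, ℂ) g x) :
    MDifferentiableAt 𝓘(ℝ, E) 𝓘(ℝ, ℂ) (fun y ↦ f y * g y) x :=
  (hf.hasMFDerivAt.mul' hg.hasMFDerivAt).mdifferentiableAt

theorem mvfderiv_congr {f g : M → ℂ} {x : M} (h : ∀ᶠ y in 𝓝 x, f y = g y) :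
    mvfderiv 𝓘(ℝ, E) f x = mvfderiv 𝓘(ℝ, E) g x := by
  have h' : f =ᶠ[𝓝 x] g := h
  ext X
  exact congrArg (fun T : E →L[ℝ] ℂ ↦ T X) h'.mfderiv_eq

theorem mvfderiv_comp_apply {f : N → ℂ} {p : M → N} {x : M}
    (hf : MDifferentiableAt 𝓘(ℝ, E') 𝓘(ℝ, ℂ) f (p x))
    (hp : MDifferentiableAt 𝓘(ℝ, E) 𝓘(ℝ, E') p x) (X : TangentSpace 𝓘(ℝ, E) x) :
    mvfderiv 𝓘(ℝ, E) (fun y ↦ f (p y)) x X =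
      mvfderiv 𝓘(ℝ, E') f (p x) (mfderiv 𝓘(ℝ, E) 𝓘(ℝ, E') p x X) :=
  congrArg (fun T : E →L[ℝ] ℂ ↦ T X) (mfderiv_comp x hf hp)

/-- The value at `X` of the `(1,0)`-form `∂ log H`, for a real function `H`. -/
def logForm (H : M → ℂ) (x : M) (X : TangentSpace 𝓘(ℝ, E) x) : ℂ :=
  (mvfderiv 𝓘(ℝ, E) H x X - Complex.I * mvfderiv 𝓘(ℝ, E) H x (tangentI X)) / (2 * H x)

/-- Since `dp` commutes with `i`, pullback preserves the `(1,0)`-part of `dH`. This lets connections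
on different manifolds be compared through functions on one common source. -/
theorem logForm_comp {H : N → ℂ} {p : M → N} {x : M}
    (hH : MDifferentiableAt 𝓘(ℝ, E') 𝓘(ℝ, ℂ) H (p x))
    (hp : ContMDiffAt 𝓘(ℂ, E) 𝓘(ℂ, E') ω p x) (X : TangentSpace 𝓘(ℝ, E) x) :
    logForm (fun y ↦ H (p y)) x X = logForm H (p x) (mfderiv 𝓘(ℝ, E) 𝓘(ℝ, E') p x X) := by
  have hp' := (contMDiffAt_restrictScalars hp).mdifferentiableAt (by simp)
  simp only [logForm, mvfderiv_comp_apply hH hp',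
    mfderiv_tangentI (hp.mdifferentiableAt (by simp))]

/-- This is the `(1,0)`-type of the form, the source of holomorphic compatibility of the Chern
connection. -/
theorem logForm_tangentI (H : M → ℂ) (x : M) (X : TangentSpace 𝓘(ℝ, E) x) :
    logForm H x (tangentI X) = Complex.I * logForm H x X := by
  simp only [logForm, tangentI_tangentI, map_neg]
  ring_nf
  simp only [Complex.I_sq]
  ring

end RealStructure

/-! ### Local holomorphic frames and coordinates of a line bundle. -/

namespace HolLineBundle

variable {E : Type u} [NormedAddCommGroup E] [NormedSpace ℂ E]
  {M : Type v} [TopologicalSpace M] [ChartedSpace E M]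
  (L : HolLineBundle.{u, v, w} E M)

/-- The complex coordinate changes are analytic, and restriction of scalars is a continuous
real-linear map between the operator spaces, so the real coordinate changes are smooth. -/
instance contMDiffVectorBundleReal : ContMDiffVectorBundle ∞ ℂ L.Fiber 𝓘(ℝ, E) where
  contMDiffOn_coordChangeL e e' he he' := by
    intro x hx
    have h := contMDiffWithinAt_restrictScalars
      (ContMDiffVectorBundle.contMDiffOn_coordChangeL (n := ω) (IB := 𝓘(ℂ, E)) (𝕜 := ℂ)
        (F := ℂ) (E := L.Fiber) e e' x hx)
    have h' := (ContinuousLinearMap.restrictScalarsL ℂ ℂ ℂ ℝ ℝ).contMDiff.contMDiffAt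
      |>.comp_contMDiffWithinAt x h
    refine h'.congr_of_mem (fun b hb ↦ ?_) hx
    ext1
    simp [Trivialization.coordChangeL_apply _ _ hb]

/-- The domain of the preferred trivialisation at `x₀`. -/
def frameSet (x₀ : M) : Set M := (trivializationAt ℂ L.Fiber x₀).baseSet

/-- The holomorphic frame near `x₀` given by the preferred trivialisation. -/
def frame (x₀ y : M) : L.Fiber y := (trivializationAt ℂ L.Fiber x₀).symm y 1

/-- The coordinate with respect to the frame near `x₀`. -/
def coord (x₀ y : M) (v : L.Fiber y) : ℂ := (trivializationAt ℂ L.Fiber x₀ ⟨y, v⟩).2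

theorem isOpen_frameSet (x₀ : M) : IsOpen (L.frameSet x₀) :=
  (trivializationAt ℂ L.Fiber x₀).open_baseSet

theorem mem_frameSet (x₀ : M) : x₀ ∈ L.frameSet x₀ := mem_baseSet_trivializationAt _ _ _

theorem frameSet_mem_nhds (x₀ : M) : L.frameSet x₀ ∈ 𝓝 x₀ :=
  (L.isOpen_frameSet x₀).mem_nhds (L.mem_frameSet x₀)

variable {L} {x₀ y : M}

theorem coord_add (hy : y ∈ L.frameSet x₀) (a b : L.Fiber y) :
    L.coord x₀ y (a + b) = L.coord x₀ y a + L.coord x₀ y b :=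
  ((trivializationAt ℂ L.Fiber x₀).linear ℂ hy).map_add a b

theorem coord_smul (hy : y ∈ L.frameSet x₀) (c : ℂ) (a : L.Fiber y) :
    L.coord x₀ y (c • a) = c * L.coord x₀ y a :=
  ((trivializationAt ℂ L.Fiber x₀).linear ℂ hy).map_smul c a

theorem coord_frame (hy : y ∈ L.frameSet x₀) : L.coord x₀ y (L.frame x₀ y) = 1 := by
  simp only [coord, frame]
  rw [Trivialization.apply_mk_symm _ hy]

theorem frame_ne_zero (hy : y ∈ L.frameSet x₀) : L.frame x₀ y ≠ 0 := by
  intro h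
  have h1 := coord_frame hy
  have h2 := coord_smul hy 0 (L.frame x₀ y)
  rw [zero_smul, zero_mul, ← h, h1] at h2
  exact one_ne_zero h2

theorem coord_smul_frame (hy : y ∈ L.frameSet x₀) (a : L.Fiber y) :
    L.coord x₀ y a • L.frame x₀ y = a := by
  have h1 := (trivializationAt ℂ L.Fiber x₀).symm_apply_apply_mk hy a
  have h2 := ((trivializationAt ℂ L.Fiber x₀).symmₗ ℂ y).map_smul (L.coord x₀ y a) 1
  simp only [Trivialization.symmₗ_apply _ hy, smul_eq_mul, mul_one] at h2
  exact h2.symm.trans h1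

theorem holAlong_iff_coord {N : Type v₁} [TopologicalSpace N] [ChartedSpace E N] {p : N → M} {x : N}
    {s : ∀ y, L.Fiber (p y)} (hp : ContMDiffAt 𝓘(ℂ, E) 𝓘(ℂ, E) ω p x)
    (hx : p x ∈ L.frameSet x₀) :
    L.HolAlong p s x ↔ ContMDiffAt 𝓘(ℂ, E) 𝓘(ℂ, ℂ) ω (fun y ↦ L.coord x₀ (p y) (s y)) x := by
  have h := Trivialization.contMDiffAt_iff (n := ω) (IB := 𝓘(ℂ, E)) (IM := 𝓘(ℂ, E))
    (e := trivializationAt ℂ L.Fiber x₀) (f := fun y ↦ TotalSpace.mk' ℂ (p y) (s y)) (x₀ := x)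
    ((trivializationAt ℂ L.Fiber x₀).mem_source.2 hx)
  exact h.trans ⟨fun h ↦ h.2, fun h ↦ ⟨hp, h⟩⟩

theorem holAt_iff_coord {s : ∀ y, L.Fiber y} (hx : y ∈ L.frameSet x₀) :
    L.HolAt s y ↔ ContMDiffAt 𝓘(ℂ, E) 𝓘(ℂ, ℂ) ω (fun y ↦ L.coord x₀ y (s y)) y :=
  holAlong_iff_coord contMDiffAt_id hx

theorem diffAt_iff_coord {s : ∀ y, L.Fiber y} (hx : y ∈ L.frameSet x₀) :
    L.DiffAt s y ↔ MDifferentiableAt 𝓘(ℝ, E) 𝓘(ℝ, ℂ) (fun y ↦ L.coord x₀ y (s y)) y :=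
  Trivialization.mdifferentiableAt_section_iff 𝓘(ℝ, E) (trivializationAt ℂ L.Fiber x₀) s hx

theorem smoothOn_iff_coord {s : ∀ y, L.Fiber y} {W : Set M} (hW : IsOpen W)
    (hx : W ⊆ L.frameSet x₀) :
    L.SmoothOn s W ↔ ContMDiffOn 𝓘(ℝ, E) 𝓘(ℝ, ℂ) ∞ (fun y ↦ L.coord x₀ y (s y)) W :=
  Trivialization.contMDiffOn_section_iff (n := ∞) (IB := 𝓘(ℝ, E)) (trivializationAt ℂ L.Fiber x₀)
    hW hx

theorem eventually_mem_frameSet (hy : y ∈ L.frameSet x₀) : ∀ᶠ z in 𝓝 y, z ∈ L.frameSet x₀ :=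
  (L.isOpen_frameSet x₀).mem_nhds hy

theorem holAlong_frame {N : Type v₁} [TopologicalSpace N] [ChartedSpace E N] {p : N → M} {x : N}
    (hp : ContMDiffAt 𝓘(ℂ, E) 𝓘(ℂ, E) ω p x) (hx : p x ∈ L.frameSet x₀) :
    L.HolAlong p (fun y ↦ L.frame x₀ (p y)) x := by
  rw [holAlong_iff_coord hp hx]
  refine (contMDiffAt_const (c := (1 : ℂ))).congr_of_eventuallyEq ?_
  filter_upwards [hp.continuousAt (eventually_mem_frameSet hx)] with y hy using coord_frame hy

theorem holAt_frame (hy : y ∈ L.frameSet x₀) : L.HolAt (L.frame x₀) y :=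
  holAlong_frame contMDiffAt_id hy

theorem HolAt.diffAt {s : ∀ y, L.Fiber y} (h : L.HolAt s y) : L.DiffAt s y :=
  (diffAt_iff_coord (mem_frameSet L y)).2 ((contMDiffAt_restrictScalars
    ((holAt_iff_coord (mem_frameSet L y)).1 h)).mdifferentiableAt (by simp))

theorem diffAt_frame (hy : y ∈ L.frameSet x₀) : L.DiffAt (L.frame x₀) y := (holAt_frame hy).diffAt

theorem smoothOn_frame : L.SmoothOn (L.frame x₀) (L.frameSet x₀) := by
  rw [smoothOn_iff_coord (L.isOpen_frameSet x₀) subset_rfl]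
  exact (contMDiffOn_const (c := (1 : ℂ))).congr fun y hy ↦ coord_frame hy

theorem DiffAt.add {s t : ∀ y, L.Fiber y} (hs : L.DiffAt s y) (ht : L.DiffAt t y) :
    L.DiffAt (fun z ↦ s z + t z) y :=
  mdifferentiableAt_add_section hs ht

theorem DiffAt.smul {f : M → ℂ} {s : ∀ y, L.Fiber y}
    (hf : MDifferentiableAt 𝓘(ℝ, E) 𝓘(ℝ, ℂ) f y) (hs : L.DiffAt s y) :
    L.DiffAt (fun z ↦ f z • s z) y := by
  rw [diffAt_iff_coord (mem_frameSet L y)] at hs ⊢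
  refine (mdifferentiableAt_cmul hf hs).congr_of_eventuallyEq ?_
  filter_upwards [L.frameSet_mem_nhds y] with z hz using coord_smul hz _ _

end HolLineBundle

/-! ### The square length of a holomorphic frame. -/

section Metric

variable {E : Type u} [NormedAddCommGroup E] [NormedSpace ℂ E]
  {M : Type v} [TopologicalSpace M] [ChartedSpace E M]
  {L : HolLineBundle.{u, v, w} E M} (h : HermitianMetric L)

namespace HermitianMetric

/-- The square length of the frame near `x₀`. -/
def frameNorm (x₀ y : M) : ℂ := h.form y (L.frame x₀ y) (L.frame x₀ y)

variable {h} {x₀ y : M}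

theorem conj_frameNorm : starRingEnd ℂ (h.frameNorm x₀ y) = h.frameNorm x₀ y := h.conj_symm _ _ _

theorem frameNorm_ne_zero (hy : y ∈ L.frameSet x₀) : h.frameNorm x₀ y ≠ 0 := by
  intro h0
  have := h.pos y _ (HolLineBundle.frame_ne_zero hy)
  rw [frameNorm] at h0
  rw [h0] at this
  exact lt_irrefl _ this

theorem contMDiffOn_frameNorm :
    ContMDiffOn 𝓘(ℝ, E) 𝓘(ℝ, ℂ) ∞ (h.frameNorm x₀) (L.frameSet x₀) :=
  h.smooth _ (L.isOpen_frameSet x₀) _ _ HolLineBundle.smoothOn_frame HolLineBundle.smoothOn_frame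

theorem contMDiffAt_frameNorm (hy : y ∈ L.frameSet x₀) :
    ContMDiffAt 𝓘(ℝ, E) 𝓘(ℝ, ℂ) ∞ (h.frameNorm x₀) y :=
  contMDiffOn_frameNorm.contMDiffAt ((L.isOpen_frameSet x₀).mem_nhds hy)

theorem mdifferentiableAt_frameNorm (hy : y ∈ L.frameSet x₀) :
    MDifferentiableAt 𝓘(ℝ, E) 𝓘(ℝ, ℂ) (h.frameNorm x₀) y :=
  (contMDiffAt_frameNorm hy).mdifferentiableAt (by simp)

end HermitianMetric

end Metric

/-! ### Smoothness of `df` and `∂ log H` in tangent coordinates. -/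

section Coordinates

variable {E : Type u} [NormedAddCommGroup E] [NormedSpace ℂ E]
  {M : Type v} [TopologicalSpace M] [ChartedSpace E M]

/-- The form `∂ log H` as a continuous linear map. -/
def logFormL (H : M → ℂ) (x : M) : TangentSpace 𝓘(ℝ, E) x →L[ℝ] ℂ :=
  let D : E →L[ℝ] ℂ := mvfderiv 𝓘(ℝ, E) H x
  ((2 * H x)⁻¹ • (D - Complex.I • (D ∘L (Complex.I • ContinuousLinearMap.id ℝ E))) : E →L[ℝ] ℂ)

theorem logFormL_apply (H : M → ℂ) (x : M) (X : TangentSpace 𝓘(ℝ, E) x) :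
    logFormL H x X = logForm H x X := by
  rw [logForm, div_eq_mul_inv, mul_comm]
  rfl

variable [IsManifold 𝓘(ℂ, E) ω M]

/-- The identification of the model space with the tangent space at `y` given by the preferred chart
at `x₀`. -/
def chartDeriv (x₀ y : M) : E →L[ℝ] TangentSpace 𝓘(ℝ, E) y :=
  (trivializationAt E (TangentSpace 𝓘(ℝ, E)) x₀).symmL ℝ y

/-- The complex structure on a tangent space is defined by the preferred chart at that point. It
does not depend on this choice: `chartDeriv x₀ y` is the derivative of the inverse chart at `x₀`,
which is holomorphic, so `mfderiv_tangentI` applies. -/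
theorem chartDeriv_smul_I {x₀ y : M} (hy : y ∈ (chartAt E x₀).source) (X : E) :
    chartDeriv x₀ y (Complex.I • X) = tangentI (chartDeriv x₀ y X) := by
  have hy' : (extChartAt 𝓘(ℝ, E) x₀).symm (extChartAt 𝓘(ℝ, E) x₀ y) = y :=
    (extChartAt 𝓘(ℝ, E) x₀).left_inv (by simpa using hy)
  have h : MDifferentiableAt 𝓘(ℂ, E) 𝓘(ℂ, E) (extChartAt 𝓘(ℂ, E) x₀).symm
      (extChartAt 𝓘(ℂ, E) x₀ y) := by
    have : IsManifold 𝓘(ℂ, E) 1 M := .of_le (n := ω) le_top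
    have h := mdifferentiableWithinAt_extChartAt_symm (I := 𝓘(ℂ, E)) (x := x₀)
      ((extChartAt 𝓘(ℂ, E) x₀).map_source (by simpa using hy))
    rw [modelWithCornersSelf_coe, Set.range_id, mdifferentiableWithinAt_univ] at h
    exact h
  have h1 := TangentBundle.symmL_trivializationAt (I := 𝓘(ℝ, E)) hy
  rw [modelWithCornersSelf_coe, Set.range_id, mfderivWithin_univ] at h1
  have h2 := mfderiv_tangentI h X
  have h3 : ∀ Y : E, (chartDeriv x₀ y Y : E) =
    mfderiv 𝓘(ℝ, E) 𝓘(ℝ, E) (extChartAt 𝓘(ℝ, E) x₀).symm (extChartAt 𝓘(ℝ, E) x₀ y) Y :=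
    fun Y ↦ congrArg (fun T : E →L[ℝ] E ↦ T Y) h1
  refine (h3 _).trans (h2.trans ?_)
  exact congrArg (fun Z : E ↦ Complex.I • Z) (h3 X).symm

theorem contMDiffAt_mvfderiv_comp_chartDeriv {f : M → ℂ} {x₀ : M}
    (hf : ContMDiffAt 𝓘(ℝ, E) 𝓘(ℝ, ℂ) ∞ f x₀) :
    ContMDiffAt 𝓘(ℝ, E) 𝓘(ℝ, E →L[ℝ] ℂ) ∞
      (fun y ↦ mvfderiv 𝓘(ℝ, E) f y ∘L chartDeriv x₀ y) x₀ := by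
  refine (hf.mfderiv_const (m := ∞) (by simp)).congr_of_eventuallyEq ?_
  filter_upwards [chart_source_mem_nhds E x₀] with y hy
  rw [inTangentCoordinates_eq_mfderiv_comp (by exact hy) (Set.mem_univ (f y))]
  have hT := TangentBundle.symmL_trivializationAt (I := 𝓘(ℝ, E)) hy
  -- The chart of the target `ℂ` is the identity, so only the source chart remains in the coordinate
  -- expression of the derivative.
  have hid : mfderiv 𝓘(ℝ, ℂ) 𝓘(ℝ, ℂ) (extChartAt 𝓘(ℝ, ℂ) (f x₀)) (f y) =
      ContinuousLinearMap.id ℝ _ := by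
    rw [extChartAt_model_space_eq_id]
    exact mfderiv_id
  let D : E →L[ℝ] ℂ := mfderiv 𝓘(ℝ, E) 𝓘(ℝ, ℂ) f y
  ext X
  exact (congrArg (fun T : E →L[ℝ] E ↦ D (T X)) hT).trans
    (congrArg (fun S : ℂ →L[ℝ] ℂ ↦ S (D (mfderivWithin 𝓘(ℝ, E) 𝓘(ℝ, E)
      (extChartAt 𝓘(ℝ, E) x₀).symm (Set.range 𝓘(ℝ, E)) (extChartAt 𝓘(ℝ, E) x₀ y) X))) hid).symm

theorem contMDiffAt_logFormL_comp_chartDeriv {H : M → ℂ} {x₀ : M}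
    (hH : ContMDiffAt 𝓘(ℝ, E) 𝓘(ℝ, ℂ) ∞ H x₀) (h0 : H x₀ ≠ 0) :
    ContMDiffAt 𝓘(ℝ, E) 𝓘(ℝ, E →L[ℝ] ℂ) ∞ (fun y ↦ logFormL (E := E) H y ∘L chartDeriv x₀ y) x₀ := by
  have h1 := contMDiffAt_mvfderiv_comp_chartDeriv hH
  have hinv : ContMDiffAt 𝓘(ℝ, E) 𝓘(ℝ, ℂ) ∞ (fun y ↦ (2 * H y)⁻¹) x₀ := by
    have : ContDiffAt ℝ ∞ (fun z : ℂ ↦ (2 * z)⁻¹) (H x₀) :=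
      (contDiffAt_const.mul contDiffAt_id).inv (by simpa using h0)
    exact this.contMDiffAt.comp x₀ hH
  -- `Φ` sends `D` to `D - i D(i ·)`, twice the `(1,0)`-part. By `chartDeriv_smul_I` it is the same
  -- fixed operator in tangent coordinates at every nearby point, so smoothness of `dH` passes to
  -- `∂H`.
  let Φ : (E →L[ℝ] ℂ) →L[ℝ] (E →L[ℝ] ℂ) := ContinuousLinearMap.id ℝ _ -
    Complex.I • ((ContinuousLinearMap.compL ℝ E E ℂ).flip (Complex.I • ContinuousLinearMap.id ℝ E))
  have h2 := Φ.contMDiff.contMDiffAt.comp x₀ h1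
  have hs : ContDiff ℝ ∞ (fun p : ℂ × (E →L[ℝ] ℂ) ↦ p.1 • p.2) := contDiff_fst.smul contDiff_snd
  have h3 := hs.contMDiff.contMDiffAt.comp x₀ (hinv.prodMk_space h2)
  refine h3.congr_of_eventuallyEq ?_
  filter_upwards [chart_source_mem_nhds E x₀] with y hy
  ext X
  have h4 : logForm H y (chartDeriv x₀ y X) = (2 * H y)⁻¹ *
    (mvfderiv 𝓘(ℝ, E) H y (chartDeriv x₀ y X) - Complex.I *
      mvfderiv 𝓘(ℝ, E) H y (chartDeriv x₀ y (Complex.I • X))) := by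
    rw [chartDeriv_smul_I hy, logForm, div_eq_mul_inv, mul_comm]
  exact (logFormL_apply _ _ _).trans h4

end Coordinates

/-! ### The Chern connection: local formula, existence and uniqueness. -/

section Chern

variable {E : Type u} [NormedAddCommGroup E] [NormedSpace ℂ E]
  {M : Type v} [TopologicalSpace M] [ChartedSpace E M]
  {L : HolLineBundle.{u, v, w} E M} (h : HermitianMetric L)

open HolLineBundle HermitianMetric

/-- The covariant derivative `D` obeys the Leibniz rule for complex functions, preserves the metric
`h`, and its `(0,1)`-part annihilates the holomorphic sections. -/
structure IsChernDerivative (D : CovariantDerivative 𝓘(ℝ, E) ℂ L.Fiber) : Prop where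
  complex_leibniz : ∀ (s : ∀ y, L.Fiber y) (f : M → ℂ) (x : M) (X : TangentSpace 𝓘(ℝ, E) x),
    L.DiffAt s x → MDifferentiableAt 𝓘(ℝ, E) 𝓘(ℝ, ℂ) f x →
    D.toFun (fun y ↦ f y • s y) x X = f x • D.toFun s x X + mvfderiv 𝓘(ℝ, E) f x X • s x
  preservesMetric : ∀ (s t : ∀ y, L.Fiber y) (x : M) (X : TangentSpace 𝓘(ℝ, E) x),
    L.DiffAt s x → L.DiffAt t x →
    mvfderiv 𝓘(ℝ, E) (fun y ↦ h.form y (s y) (t y)) x X =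
      h.form x (D.toFun s x X) (t x) + h.form x (s x) (D.toFun t x X)
  holCompatible : ∀ (s : ∀ y, L.Fiber y) (x : M) (X : TangentSpace 𝓘(ℝ, E) x), L.HolAt s x →
    D.toFun s x (tangentI X) = Complex.I • D.toFun s x X

variable {h} {x₀ y : M}

/-- The value at `X` of the covariant derivative of `s` in the frame near `x₀`. -/
def chernCoord (h : HermitianMetric L) (x₀ : M) (s : ∀ y, L.Fiber y) (y : M)
    (X : TangentSpace 𝓘(ℝ, E) y) : ℂ :=
  mvfderiv 𝓘(ℝ, E) (fun z ↦ L.coord x₀ z (s z)) y X +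
    L.coord x₀ y (s y) * logForm (h.frameNorm x₀) y X

/-- Let `θ` be the coefficient at `X`. As the frame is holomorphic, the coefficient at `iX` is `iθ`.
The metric condition gives `dH(X) = (θ̄ + θ)H` and `dH(iX) = (-iθ̄ + iθ)H`, and `dH(X) - i dH(iX)`
eliminates `θ̄`. -/
theorem IsChernDerivative.apply_frame {D : CovariantDerivative 𝓘(ℝ, E) ℂ L.Fiber}
    (hD : IsChernDerivative h D) (hy : y ∈ L.frameSet x₀) (X : TangentSpace 𝓘(ℝ, E) y) :
    D.toFun (L.frame x₀) y X = logForm (h.frameNorm x₀) y X • L.frame x₀ y := by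
  set θ := L.coord x₀ y (D.toFun (L.frame x₀) y X)
  have h1 : D.toFun (L.frame x₀) y X = θ • L.frame x₀ y := (coord_smul_frame hy _).symm
  have h2 := hD.holCompatible _ _ X (holAt_frame hy)
  have h3 := hD.preservesMetric _ _ _ X (diffAt_frame hy) (diffAt_frame hy)
  have h4 := hD.preservesMetric _ _ _ (tangentI X) (diffAt_frame hy) (diffAt_frame hy)
  rw [h2] at h4
  rw [h1] at h3 h4 ⊢
  simp only [map_smulₛₗ, LinearMap.smul_apply, smul_eq_mul, RingHom.id_apply, Complex.conj_I]
    at h3 h4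
  have h5 := frameNorm_ne_zero (h := h) hy
  congr 1
  rw [logForm, eq_div_iff (mul_ne_zero two_ne_zero h5)]
  have h6 : mvfderiv 𝓘(ℝ, E) (h.frameNorm x₀) y X = _ := h3
  have h7 : mvfderiv 𝓘(ℝ, E) (h.frameNorm x₀) y (tangentI X) = _ := h4
  rw [h6, h7, frameNorm]
  ring_nf
  simp only [Complex.I_sq]
  ring

/-- Locality replaces `s` by its coordinate times the frame; the complex Leibniz rule does the rest.
As `x₀` is any point whose frame is defined at `y`, this yields both uniqueness and independence of
the frame. -/
theorem IsChernDerivative.apply {D : CovariantDerivative 𝓘(ℝ, E) ℂ L.Fiber}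
    (hD : IsChernDerivative h D) (hy : y ∈ L.frameSet x₀) {s : ∀ y, L.Fiber y} (hs : L.DiffAt s y)
    (X : TangentSpace 𝓘(ℝ, E) y) :
    D.toFun s y X = chernCoord h x₀ s y X • L.frame x₀ y := by
  have hc := (diffAt_iff_coord hy).1 hs
  have h1 : D.toFun s y = D.toFun (fun z ↦ L.coord x₀ z (s z) • L.frame x₀ z) y := by
    refine D.isCovariantDerivativeOnUniv.congr_of_eventuallyEq hs
      (DiffAt.smul hc (diffAt_frame hy)) univ_mem ?_
    filter_upwards [eventually_mem_frameSet hy] with z hz using (coord_smul_frame hz _).symm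
  rw [h1, hD.complex_leibniz _ _ _ _ (diffAt_frame hy) hc, hD.apply_frame hy, smul_smul, ← add_smul,
    add_comm, chernCoord]

variable (h) in
open Classical in
/-- The Chern connection, as a function on all sections. -/
def chernFun (s : ∀ y, L.Fiber y) (x : M) : TangentSpace 𝓘(ℝ, E) x →L[ℝ] L.Fiber x :=
  -- The value at `x` uses the frame based at `x` itself, so no global choice is needed. The default
  -- `0` is the one required by `eq_zero_of_not_diffAt`.
  if L.DiffAt s x then
    { toFun := fun X ↦ chernCoord h x s x X • L.frame x x
      map_add' := fun X Y ↦ by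
        simp only [chernCoord, ← logFormL_apply, map_add, mul_add, add_smul]
        abel
      map_smul' := fun c X ↦ by
        simp only [chernCoord, ← logFormL_apply, map_smul, RingHom.id_apply, mul_smul_comm,
          ← smul_add, smul_assoc]
      cont := by
        simp only [chernCoord, ← logFormL_apply]
        fun_prop }
  else 0

theorem chernFun_apply {s : ∀ y, L.Fiber y} {x : M} (hs : L.DiffAt s x)
    (X : TangentSpace 𝓘(ℝ, E) x) : chernFun h s x X = chernCoord h x s x X • L.frame x x := by
  rw [chernFun, if_pos hs]
  rfl

theorem chernFun_add {s t : ∀ y, L.Fiber y} {x : M} (hs : L.DiffAt s x) (ht : L.DiffAt t x) :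
    chernFun h (s + t) x = chernFun h s x + chernFun h t x := by
  have hst : L.DiffAt (s + t) x := hs.add ht
  ext X
  have h0 := L.mem_frameSet x
  have h1 : mvfderiv 𝓘(ℝ, E) (fun z ↦ L.coord x z ((s + t) z)) x X =
      mvfderiv 𝓘(ℝ, E) (fun z ↦ L.coord x z (s z)) x X +
        mvfderiv 𝓘(ℝ, E) (fun z ↦ L.coord x z (t z)) x X := by
    rw [mvfderiv_congr (g := fun z ↦ L.coord x z (s z) + L.coord x z (t z)) (by
      filter_upwards [L.frameSet_mem_nhds x] with z hz using coord_add hz _ _),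
      mvfderiv_fun_add ((diffAt_iff_coord h0).1 hs) ((diffAt_iff_coord h0).1 ht)]
    rfl
  have h2 : L.coord x x ((s + t) x) = _ := coord_add h0 (s x) (t x)
  rw [add_apply, chernFun_apply hs, chernFun_apply ht, chernFun_apply hst,
    ← add_smul]
  simp only [chernCoord, h1, h2]
  ring_nf

theorem chernFun_smul {f : M → ℂ} {s : ∀ y, L.Fiber y} {x : M}
    (hs : L.DiffAt s x) (hf : MDifferentiableAt 𝓘(ℝ, E) 𝓘(ℝ, ℂ) f x)
    (X : TangentSpace 𝓘(ℝ, E) x) :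
    chernFun h (fun y ↦ f y • s y) x X = f x • chernFun h s x X + mvfderiv 𝓘(ℝ, E) f x X • s x := by
  have h0 := L.mem_frameSet x
  have h1 : mvfderiv 𝓘(ℝ, E) (fun z ↦ L.coord x z (f z • s z)) x X =
      f x * mvfderiv 𝓘(ℝ, E) (fun z ↦ L.coord x z (s z)) x X +
        mvfderiv 𝓘(ℝ, E) f x X * L.coord x x (s x) := by
    rw [mvfderiv_congr (g := fun z ↦ f z * L.coord x z (s z)) (by
      filter_upwards [L.frameSet_mem_nhds x] with z hz using coord_smul hz _ _),
      mvfderiv_cmul hf ((diffAt_iff_coord h0).1 hs)]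
  have h2 : mvfderiv 𝓘(ℝ, E) f x X • s x =
      (mvfderiv 𝓘(ℝ, E) f x X * L.coord x x (s x)) • L.frame x x := by
    rw [← smul_smul, coord_smul_frame h0]
  rw [chernFun_apply hs, chernFun_apply (hs.smul hf), h2]
  simp only [chernCoord, h1, smul_smul, ← add_smul, coord_smul h0]
  ring_nf

theorem mdifferentiableAt_ofReal_comp {f : M → ℝ} {x : M}
    (hf : MDifferentiableAt 𝓘(ℝ, E) 𝓘(ℝ, ℝ) f x) :
    MDifferentiableAt 𝓘(ℝ, E) 𝓘(ℝ, ℂ) (fun y ↦ (f y : ℂ)) x :=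
  ((Complex.ofRealCLM.hasMFDerivAt (x := f x)).comp x hf.hasMFDerivAt).mdifferentiableAt

theorem mvfderiv_ofReal_comp {f : M → ℝ} {x : M}
    (hf : MDifferentiableAt 𝓘(ℝ, E) 𝓘(ℝ, ℝ) f x) (X : TangentSpace 𝓘(ℝ, E) x) :
    mvfderiv 𝓘(ℝ, E) (fun y ↦ (f y : ℂ)) x X = (mvfderiv 𝓘(ℝ, E) f x X : ℝ) :=
  congrArg (fun T : E →L[ℝ] ℂ ↦ T X)
    ((Complex.ofRealCLM.hasMFDerivAt (x := f x)).comp x hf.hasMFDerivAt).mfderiv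

variable (h) in
/-- The covariant derivative of the Chern connection. -/
def chernDerivative : CovariantDerivative 𝓘(ℝ, E) ℂ L.Fiber where
  toFun := chernFun h
  isCovariantDerivativeOnUniv :=
    { add := fun hs ht _ ↦ chernFun_add hs ht
      leibniz := fun {s g x} hs hg _ ↦ by
        -- The Leibniz rule is asked for real functions here; coercion to `ℂ` reduces it to the
        -- complex rule `chernFun_smul`.
        have h1 : (g • s) = fun y ↦ (g y : ℂ) • s y := by
          ext y
          exact (Complex.coe_smul (g y) (s y)).symm
        ext X
        rw [h1, chernFun_smul hs (mdifferentiableAt_ofReal_comp hg), mvfderiv_ofReal_comp hg]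
        simp only [Complex.coe_smul]
        rfl }

/-- Because `H` is real, so is `dH`, and the terms `±i dH(iX)` cancel in `θ̄ + θ`. -/
theorem logForm_add_conj {x : M} (X : TangentSpace 𝓘(ℝ, E) x) (hy : x ∈ L.frameSet x₀) :
    mvfderiv 𝓘(ℝ, E) (h.frameNorm x₀) x X =
      (starRingEnd ℂ (logForm (h.frameNorm x₀) x X) + logForm (h.frameNorm x₀) x X) *
        h.frameNorm x₀ x := by
  have h0 := frameNorm_ne_zero (h := h) hy
  have hc : ∀ Y : TangentSpace 𝓘(ℝ, E) x, starRingEnd ℂ (mvfderiv 𝓘(ℝ, E) (h.frameNorm x₀) x Y) =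
      mvfderiv 𝓘(ℝ, E) (h.frameNorm x₀) x Y := fun Y ↦ by
    rw [← mvfderiv_conj (mdifferentiableAt_frameNorm hy)]
    simp only [conj_frameNorm]
  simp only [logForm, map_div₀, map_sub, map_mul, hc, conj_frameNorm, Complex.conj_I, map_ofNat]
  field_simp
  ring

theorem form_eq_coord (hy : y ∈ L.frameSet x₀) (a b : L.Fiber y) :
    h.form y a b = starRingEnd ℂ (L.coord x₀ y a) * (L.coord x₀ y b * h.frameNorm x₀ y) := by
  conv_lhs => rw [← coord_smul_frame hy a, ← coord_smul_frame hy b]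
  simp only [map_smulₛₗ, LinearMap.smul_apply, smul_eq_mul, RingHom.id_apply, frameNorm]
  ring

/-- In coordinates `⟨s, t⟩ = f̄ g H`; the product rule with `dH = (θ̄ + θ)H` gives the metric
condition. For holomorphic `s`, both `df` and `θ` are complex linear, hence so is `∇s`. -/
theorem isChernDerivative_chernDerivative : IsChernDerivative h (chernDerivative h) where
  complex_leibniz s f x X hs hf := chernFun_smul hs hf X
  preservesMetric s t x X hs ht := by
    have h0 := L.mem_frameSet x
    have ds := (diffAt_iff_coord h0).1 hs
    have dt := (diffAt_iff_coord h0).1 ht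
    have h1 : mvfderiv 𝓘(ℝ, E) (fun y ↦ h.form y (s y) (t y)) x X =
        mvfderiv 𝓘(ℝ, E) (fun y ↦ starRingEnd ℂ (L.coord x y (s y)) *
          (L.coord x y (t y) * h.frameNorm x y)) x X := by
      rw [mvfderiv_congr]
      filter_upwards [L.frameSet_mem_nhds x] with y hy using form_eq_coord hy _ _
    have dH := mdifferentiableAt_frameNorm (h := h) h0
    rw [h1, mvfderiv_cmul (mdifferentiableAt_conj ds) (mdifferentiableAt_cmul dt dH),
      mvfderiv_cmul dt dH, mvfderiv_conj ds, logForm_add_conj X h0]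
    change _ = h.form x (chernFun h s x X) (t x) + h.form x (s x) (chernFun h t x X)
    rw [chernFun_apply hs, chernFun_apply ht]
    simp only [form_eq_coord h0, coord_smul h0, coord_frame h0, chernCoord, map_add, map_mul,
      mul_one]
    ring
  holCompatible s x X hs := by
    change chernFun h s x (tangentI X) = Complex.I • chernFun h s x X
    have h1 := ((holAt_iff_coord (L.mem_frameSet x)).1 hs).mdifferentiableAt (by simp)
    rw [chernFun_apply hs.diffAt, chernFun_apply hs.diffAt, chernCoord, chernCoord,
      mvfderiv_tangentI h1, logForm_tangentI, smul_smul]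
    ring_nf

/-- The frame used in `chernFun` changes with the point, with no continuity.
`IsChernDerivative.apply` rewrites the value in the fixed frame at `x₀`, where it is `df + f ∂ log
H` with smooth `f` and `H`. -/
theorem contMDiffCovariantDerivativeOn_chernFun [IsManifold 𝓘(ℂ, E) ω M] {W : Set M}
    (hW : IsOpen W) : ContMDiffCovariantDerivativeOn ℂ ∞ (chernFun h) W where
  contMDiff {s} hs x₀ hx₀ := by
    have hs' : ∀ y ∈ W, ContMDiffAt 𝓘(ℝ, E) (𝓘(ℝ, E).prod 𝓘(ℝ, ℂ)) ∞
      (fun y ↦ TotalSpace.mk' ℂ y (s y)) y := fun y hy ↦ hs.contMDiffAt (hW.mem_nhds hy)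
    refine ContMDiffAt.contMDiffWithinAt ?_
    rw [contMDiffAt_hom_bundle]
    refine ⟨contMDiffAt_id, ?_⟩
    have hf : ContMDiffAt 𝓘(ℝ, E) 𝓘(ℝ, ℂ) ∞ (fun y ↦ L.coord x₀ y (s y)) x₀ :=
      (contMDiffAt_section x₀).1 (hs' x₀ hx₀)
    have h0 := L.mem_frameSet x₀
    have h1 := contMDiffAt_mvfderiv_comp_chartDeriv hf
    have h2 := contMDiffAt_logFormL_comp_chartDeriv (contMDiffAt_frameNorm (h := h) h0)
      (frameNorm_ne_zero h0)
    have hsm : ContDiff ℝ ∞ (fun p : ℂ × (E →L[ℝ] ℂ) ↦ p.1 • p.2) :=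
      contDiff_fst.smul contDiff_snd
    have h3 := h1.add (hsm.contMDiff.contMDiffAt.comp x₀ (hf.prodMk_space h2))
    refine h3.congr_of_eventuallyEq ?_
    filter_upwards [L.frameSet_mem_nhds x₀, hW.mem_nhds hx₀] with y hy hyW
    have hsy : L.DiffAt s y := (hs' y hyW).mdifferentiableAt (by simp)
    ext X
    -- Coordinates of the hom bundle: tangent vectors enter through `chartDeriv`, and values are
    -- read by `coord`.
    have h4 : ContinuousLinearMap.inCoordinates E (TangentSpace 𝓘(ℝ, E)) ℂ L.Fiber x₀ y x₀ y
        (chernFun h s y) X = L.coord x₀ y (chernFun h s y (chartDeriv x₀ y X)) := by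
      simp only [ContinuousLinearMap.inCoordinates, ContinuousLinearMap.comp_apply,
        Trivialization.continuousLinearMapAt_apply]
      rw [Trivialization.coe_linearMapAt_of_mem _ hy]
      rfl
    refine h4.trans ?_
    have h5 : chernFun h s y (chartDeriv x₀ y X) = _ :=
      isChernDerivative_chernDerivative.apply hy hsy (chartDeriv x₀ y X)
    rw [h5, coord_smul hy, coord_frame hy, mul_one, chernCoord, ← logFormL_apply]
    rfl

variable [IsManifold 𝓘(ℂ, E) ω M]

variable (h) in
/-- The Chern connection of a hermitian holomorphic line bundle. -/
def chernConnection : Connection L where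
  toCovariantDerivative := chernDerivative h
  complex_leibniz := isChernDerivative_chernDerivative.complex_leibniz
  smooth _ hW := contMDiffCovariantDerivativeOn_chernFun hW
  eq_zero_of_not_diffAt _ _ hs := if_neg hs

theorem Connection.isChernDerivative {D : Connection L} (h₁ : D.PreservesMetric h)
    (h₂ : D.IsHolCompatible) : IsChernDerivative h D.toCovariantDerivative :=
  ⟨D.complex_leibniz, h₁, h₂⟩

theorem preservesMetric_chernConnection : (chernConnection h).PreservesMetric h :=
  isChernDerivative_chernDerivative.preservesMetric

theorem isHolCompatible_chernConnection : (chernConnection h).IsHolCompatible :=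
  (isChernDerivative_chernDerivative (h := h)).holCompatible

/-- Both sides obey the same local formula on differentiable sections, and the normalisation makes
both vanish on all others. -/
theorem Connection.eq_chernConnection {D : Connection L} (h₁ : D.PreservesMetric h)
    (h₂ : D.IsHolCompatible) : D = chernConnection h := by
  ext s x X
  by_cases hs : L.DiffAt s x
  · have hx := L.mem_frameSet x
    exact ((D.isChernDerivative h₁ h₂).apply hx hs X).trans
      (isChernDerivative_chernDerivative.apply hx hs X).symm
  · rw [D.eq_zero_of_not_diffAt s x hs, (chernConnection h).eq_zero_of_not_diffAt s x hs]

end Chern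

/-! ### Calculus of `∂ log` under change of frame. -/

section LogForm

variable {E : Type u} [NormedAddCommGroup E] [NormedSpace ℂ E]
  {N : Type v} [TopologicalSpace N] [ChartedSpace E N] {x : N}

theorem logForm_congr {F H : N → ℂ} (h : ∀ᶠ y in 𝓝 x, F y = H y) (X : TangentSpace 𝓘(ℝ, E) x) :
    logForm F x X = logForm H x X := by
  simp only [logForm, mvfderiv_congr h, h.self_of_nhds]

theorem logForm_mul {F H : N → ℂ} (hF : MDifferentiableAt 𝓘(ℝ, E) 𝓘(ℝ, ℂ) F x)
    (hH : MDifferentiableAt 𝓘(ℝ, E) 𝓘(ℝ, ℂ) H x) (hF0 : F x ≠ 0) (hH0 : H x ≠ 0)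
    (X : TangentSpace 𝓘(ℝ, E) x) :
    logForm (fun y ↦ F y * H y) x X = logForm F x X + logForm H x X := by
  simp only [logForm, mvfderiv_cmul hF hH]
  field_simp
  ring

/-- `∂ log |k|² = dk / k`, because `∂k̄ = 0` and `∂k = dk` for holomorphic `k`. -/
theorem logForm_conj_mul_self {k : N → ℂ} (hk : MDifferentiableAt 𝓘(ℂ, E) 𝓘(ℂ, ℂ) k x)
    (hk' : MDifferentiableAt 𝓘(ℝ, E) 𝓘(ℝ, ℂ) k x) (hk0 : k x ≠ 0) (X : TangentSpace 𝓘(ℝ, E) x) :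
    k x * logForm (fun y ↦ starRingEnd ℂ (k y) * k y) x X = mvfderiv 𝓘(ℝ, E) k x X := by
  have hc : starRingEnd ℂ (k x) ≠ 0 := by simpa using hk0
  simp only [logForm, mvfderiv_cmul (mdifferentiableAt_conj hk') hk', mvfderiv_conj hk',
    mvfderiv_tangentI hk, map_mul, Complex.conj_I]
  field_simp
  ring_nf
  simp only [Complex.I_sq]
  ring

/-- If `α β k = γ δ` and `A B = |k|² C D` with holomorphic `k`, then the covariant derivatives of
`α β` and `γ δ` for the metrics `A B` and `C D` agree. -/
theorem chern_product_formula {α β γ δ k A B C D : N → ℂ}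
    (hα : MDifferentiableAt 𝓘(ℝ, E) 𝓘(ℝ, ℂ) α x) (hβ : MDifferentiableAt 𝓘(ℝ, E) 𝓘(ℝ, ℂ) β x)
    (hγ : MDifferentiableAt 𝓘(ℝ, E) 𝓘(ℝ, ℂ) γ x) (hδ : MDifferentiableAt 𝓘(ℝ, E) 𝓘(ℝ, ℂ) δ x)
    (hk : MDifferentiableAt 𝓘(ℂ, E) 𝓘(ℂ, ℂ) k x) (hk' : MDifferentiableAt 𝓘(ℝ, E) 𝓘(ℝ, ℂ) k x)
    (hA : MDifferentiableAt 𝓘(ℝ, E) 𝓘(ℝ, ℂ) A x) (hB : MDifferentiableAt 𝓘(ℝ, E) 𝓘(ℝ, ℂ) B x)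
    (hC : MDifferentiableAt 𝓘(ℝ, E) 𝓘(ℝ, ℂ) C x) (hD : MDifferentiableAt 𝓘(ℝ, E) 𝓘(ℝ, ℂ) D x)
    (hk0 : k x ≠ 0) (hA0 : A x ≠ 0) (hB0 : B x ≠ 0) (hC0 : C x ≠ 0) (hD0 : D x ≠ 0)
    (h₁ : ∀ᶠ y in 𝓝 x, α y * β y * k y = γ y * δ y)
    (h₂ : ∀ᶠ y in 𝓝 x, A y * B y = starRingEnd ℂ (k y) * k y * (C y * D y))
    (X : TangentSpace 𝓘(ℝ, E) x) :
    ((mvfderiv 𝓘(ℝ, E) α x X + α x * logForm A x X) * β x +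
        α x * (mvfderiv 𝓘(ℝ, E) β x X + β x * logForm B x X)) * k x =
      (mvfderiv 𝓘(ℝ, E) γ x X + γ x * logForm C x X) * δ x +
        γ x * (mvfderiv 𝓘(ℝ, E) δ x X + δ x * logForm D x X) := by
  have e₁ : mvfderiv 𝓘(ℝ, E) (fun y ↦ α y * β y * k y) x X =
      mvfderiv 𝓘(ℝ, E) (fun y ↦ γ y * δ y) x X := by rw [mvfderiv_congr h₁]
  rw [mvfderiv_cmul (mdifferentiableAt_cmul hα hβ) hk', mvfderiv_cmul hα hβ,
    mvfderiv_cmul hγ hδ] at e₁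
  have e₂ := logForm_congr h₂ X
  have hc : starRingEnd ℂ (k x) * k x ≠ 0 := by simpa using hk0
  rw [logForm_mul hA hB hA0 hB0, logForm_mul (mdifferentiableAt_cmul (mdifferentiableAt_conj hk') hk')
    (mdifferentiableAt_cmul hC hD) hc (mul_ne_zero hC0 hD0), logForm_mul hC hD hC0 hD0] at e₂
  have e₃ := logForm_conj_mul_self hk hk' hk0 X
  have e₄ := h₁.self_of_nhds
  -- The `dk` term of the product rule `e₁` cancels the `∂ log |k|²` term of `e₂` by `e₃`; `e₄`
  -- matches the remaining multiples of the forms of `C` and `D`.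
  linear_combination e₁ + α x * β x * k x * e₂ + α x * β x * e₃ +
    (logForm C x X + logForm D x X) * e₄

end LogForm

/-! ### Unitary holomorphic isomorphisms are parallel. -/

section Parallel

variable {E : Type u} [NormedAddCommGroup E] [NormedSpace ℂ E]
  {N : Type v} [TopologicalSpace N] [ChartedSpace E N]
  {M₁ : Type v₁} [TopologicalSpace M₁] [ChartedSpace E M₁]
  {M₂ : Type v₂} [TopologicalSpace M₂] [ChartedSpace E M₂]
  {M₃ : Type v₃} [TopologicalSpace M₃] [ChartedSpace E M₃]
  {M₄ : Type v₄} [TopologicalSpace M₄] [ChartedSpace E M₄]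

open HolLineBundle HermitianMetric

theorem mdifferentiableAt_coord_comp {A : HolLineBundle.{u, v₁, w₁} E M₁} {p : N → M₁} {x : N} {x₀ : M₁}
    {a : ∀ y, A.Fiber y} (hp : ContMDiffAt 𝓘(ℂ, E) 𝓘(ℂ, E) ω p x) (hx : p x ∈ A.frameSet x₀)
    (ha : A.DiffAt a (p x)) :
    MDifferentiableAt 𝓘(ℝ, E) 𝓘(ℝ, ℂ) (fun y ↦ A.coord x₀ (p y) (a (p y))) x :=
  ((diffAt_iff_coord hx).1 ha).comp x ((contMDiffAt_restrictScalars hp).mdifferentiableAt (by simp))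

theorem mdifferentiableAt_frameNorm_comp {A : HolLineBundle.{u, v₁, w₁} E M₁}
    (h : HermitianMetric A) {p : N → M₁} {x : N} {x₀ : M₁}
    (hp : ContMDiffAt 𝓘(ℂ, E) 𝓘(ℂ, E) ω p x) (hx : p x ∈ A.frameSet x₀) :
    MDifferentiableAt 𝓘(ℝ, E) 𝓘(ℝ, ℂ) (fun y ↦ h.frameNorm x₀ (p y)) x :=
  (mdifferentiableAt_frameNorm hx).comp x
    ((contMDiffAt_restrictScalars hp).mdifferentiableAt (by simp))

theorem chernCoord_comp {A : HolLineBundle.{u, v₁, w₁} E M₁} (h : HermitianMetric A) {p : N → M₁}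
    {x : N} {x₀ : M₁} {a : ∀ y, A.Fiber y} (hp : ContMDiffAt 𝓘(ℂ, E) 𝓘(ℂ, E) ω p x)
    (hx : p x ∈ A.frameSet x₀) (ha : A.DiffAt a (p x)) (X : TangentSpace 𝓘(ℝ, E) x) :
    chernCoord h x₀ a (p x) (mfderiv 𝓘(ℝ, E) 𝓘(ℝ, E) p x X) =
      mvfderiv 𝓘(ℝ, E) (fun y ↦ A.coord x₀ (p y) (a (p y))) x X +
        A.coord x₀ (p x) (a (p x)) * logForm (fun y ↦ h.frameNorm x₀ (p y)) x X := by
  rw [chernCoord, logForm_comp (mdifferentiableAt_frameNorm hx) hp,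
    mvfderiv_comp_apply (f := fun z ↦ A.coord x₀ z (a z)) ((diffAt_iff_coord hx).1 ha)
      ((contMDiffAt_restrictScalars hp).mdifferentiableAt (by simp))]

theorem tensorForm_smul_tmul_self {B : Type*} [AddCommGroup B] [Module ℂ B] {C : Type*}
    [AddCommGroup C] [Module ℂ C] (h : B →ₗ⋆[ℂ] B →ₗ[ℂ] ℂ) (k : C →ₗ⋆[ℂ] C →ₗ[ℂ] ℂ) (z : ℂ) (b : B)
    (c : C) : tensorForm h k (z • (b ⊗ₜ[ℂ] c)) (z • (b ⊗ₜ[ℂ] c)) =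
      starRingEnd ℂ z * z * (h b b * k c c) := by
  rw [TensorProduct.smul_tmul', tensorForm_tmul]
  simp only [map_smulₛₗ, LinearMap.smul_apply, smul_eq_mul, RingHom.id_apply]
  ring

theorem eq_coord_smul_tmul {B : HolLineBundle.{u, v₂, w₂} E M₂} {C : HolLineBundle.{u, v₃, w₃} E M₃}
    {x₀ y : M₂} {x₁ z : M₃} (hy : y ∈ B.frameSet x₀) (hz : z ∈ C.frameSet x₁) (b : B.Fiber y)
    (c : C.Fiber z) :
    b ⊗ₜ[ℂ] c = (B.coord x₀ y b * C.coord x₁ z c) • (B.frame x₀ y ⊗ₜ[ℂ] C.frame x₁ z) := by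
  conv_lhs => rw [← coord_smul_frame hy b, ← coord_smul_frame hz c]
  rw [TensorProduct.smul_tmul_smul]

/-- The metrics detect it: the square length of the tensor is the product of two nonzero square
lengths. -/
theorem frame_tmul_frame_ne_zero {B : HolLineBundle.{u, v₂, w₂} E M₂}
    {C : HolLineBundle.{u, v₃, w₃} E M₃} (hB : HermitianMetric B) (hC : HermitianMetric C)
    {x₀ y : M₂} {x₁ z : M₃} (hy : y ∈ B.frameSet x₀) (hz : z ∈ C.frameSet x₁) :
    B.frame x₀ y ⊗ₜ[ℂ] C.frame x₁ z ≠ 0 := by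
  intro h0
  have h1 := tensorForm_tmul (hB.form y) (hC.form z) (B.frame x₀ y) (B.frame x₀ y) (C.frame x₁ z)
    (C.frame x₁ z)
  rw [h0] at h1
  refine mul_ne_zero (frameNorm_ne_zero (h := hB) hy) (frameNorm_ne_zero (h := hC) hz)
    (h1.symm.trans ?_)
  simp [tensorForm]

variable [IsManifold 𝓘(ℂ, E) ω M₁] [IsManifold 𝓘(ℂ, E) ω M₂] [IsManifold 𝓘(ℂ, E) ω M₃]
  [IsManifold 𝓘(ℂ, E) ω M₄]

/-- A unitary holomorphic isomorphism is compatible with the Chern connections. -/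
theorem TensorIso.IsUnitary.isParallel {p : N → M₁} {A : HolLineBundle.{u, v₁, w₁} E M₁}
    {q : N → M₂} {B : HolLineBundle.{u, v₂, w₂} E M₂}
    {r : N → M₃} {C : HolLineBundle.{u, v₃, w₃} E M₃} {φ : TensorIso p A q B r C}
    {hA : HermitianMetric A} {hB : HermitianMetric B} {hC : HermitianMetric C}
    (hφ : φ.IsUnitary hA hB hC)
    (hp : ContMDiff 𝓘(ℂ, E) 𝓘(ℂ, E) ω p) (hq : ContMDiff 𝓘(ℂ, E) 𝓘(ℂ, E) ω q)
    (hr : ContMDiff 𝓘(ℂ, E) 𝓘(ℂ, E) ω r) :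
    φ.IsParallel (chernConnection hA) (chernConnection hB) (chernConnection hC) := by
  intro x a b c ha hb hc habc X
  have mA := A.mem_frameSet (p x)
  have mB := B.mem_frameSet (q x)
  have mC := C.mem_frameSet (r x)
  have nA := hp.continuous.continuousAt (A.frameSet_mem_nhds (p x))
  have nB := hq.continuous.continuousAt (B.frameSet_mem_nhds (q x))
  have nC := hr.continuous.continuousAt (C.frameSet_mem_nhds (r x))
  obtain ⟨s, t, hs, ht, hst⟩ := φ.holomorphic x _ (holAlong_frame (hp x) mA)
  rw [holAlong_iff_coord (hq x) mB] at hs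
  rw [holAlong_iff_coord (hr x) mC] at ht
  -- `k` is the matrix entry of `φ` in the three frames; it is holomorphic because `φ` carries the
  -- frame of `A` to a tensor of holomorphic sections.
  set k : N → ℂ := fun y ↦ B.coord (q x) (q y) (s y) * C.coord (r x) (r y) (t y)
  have hk : ContMDiffAt 𝓘(ℂ, E) 𝓘(ℂ, ℂ) ω k x :=
    (contDiff_fst.mul contDiff_snd :
      ContDiff ℂ ω fun z : ℂ × ℂ ↦ z.1 * z.2).contMDiff.contMDiffAt.comp x (hs.prodMk_space ht)
  have hk' := contMDiffAt_restrictScalars hk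
  have key : ∀ᶠ y in 𝓝 x, φ.equiv y (A.frame (p x) (p y)) =
      k y • (B.frame (q x) (q y) ⊗ₜ[ℂ] C.frame (r x) (r y)) := by
    filter_upwards [hst, nB, nC] with y hy hyB hyC
    rw [hy, eq_coord_smul_tmul hyB hyC]
  have frame_ne : ∀ᶠ y in 𝓝 x,
      k y • (B.frame (q x) (q y) ⊗ₜ[ℂ] C.frame (r x) (r y)) ≠ 0 := by
    filter_upwards [key, nA] with y hy hyA
    rw [← hy]
    exact (φ.equiv y).map_ne_zero_iff.2 (frame_ne_zero hyA)
  -- The factor `1`, with metric `1`, stands for a trivial second bundle on the left, so that the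
  -- four-factor `chern_product_formula` applies.
  have h₁ : ∀ᶠ y in 𝓝 x, A.coord (p x) (p y) (a (p y)) * 1 * k y =
      B.coord (q x) (q y) (b (q y)) * C.coord (r x) (r y) (c (r y)) := by
    filter_upwards [key, frame_ne, habc, nA, nB, nC] with y hy hy0 hyabc hyA hyB hyC
    rw [← coord_smul_frame hyA (a (p y)), map_smul, hy, eq_coord_smul_tmul hyB hyC (b _) (c _),
      smul_smul] at hyabc
    rw [mul_one]
    exact smul_left_injective ℂ (smul_ne_zero_iff.1 hy0).2 hyabc
  -- Unitarity, evaluated on the frame of `A`.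
  have h₂ : ∀ᶠ y in 𝓝 x, hA.frameNorm (p x) (p y) * 1 = starRingEnd ℂ (k y) * k y *
      (hB.frameNorm (q x) (q y) * hC.frameNorm (r x) (r y)) := by
    filter_upwards [key] with y hy
    have := hφ y (A.frame (p x) (p y)) (A.frame (p x) (p y))
    rw [hy, tensorForm_smul_tmul_self] at this
    rw [mul_one]
    exact this.symm
  have main := chern_product_formula (mdifferentiableAt_coord_comp (hp x) mA ha) mdifferentiableAt_const
    (mdifferentiableAt_coord_comp (hq x) mB hb) (mdifferentiableAt_coord_comp (hr x) mC hc)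
    (hk.mdifferentiableAt (by simp)) (hk'.mdifferentiableAt (by simp))
    (mdifferentiableAt_frameNorm_comp hA (hp x) mA) mdifferentiableAt_const
    (mdifferentiableAt_frameNorm_comp hB (hq x) mB) (mdifferentiableAt_frameNorm_comp hC (hr x) mC)
    (smul_ne_zero_iff.1 frame_ne.self_of_nhds).1 (frameNorm_ne_zero mA) one_ne_zero
    (frameNorm_ne_zero mB) (frameNorm_ne_zero mC) h₁ h₂ X
  have h1 : mvfderiv 𝓘(ℝ, E) (fun _ : N ↦ (1 : ℂ)) x = 0 := mvfderiv_const _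
  have hl : logForm (fun _ : N ↦ (1 : ℂ)) x X = 0 := by simp [logForm, h1]
  rw [hl, h1, ← chernCoord_comp hA (hp x) mA ha, ← chernCoord_comp hB (hq x) mB hb,
    ← chernCoord_comp hC (hr x) mC hc] at main
  have dA := chernFun_apply (h := hA) ha (mfderiv 𝓘(ℝ, E) 𝓘(ℝ, E) p x X)
  have dB := chernFun_apply (h := hB) hb (mfderiv 𝓘(ℝ, E) 𝓘(ℝ, E) q x X)
  have dC := chernFun_apply (h := hC) hc (mfderiv 𝓘(ℝ, E) 𝓘(ℝ, E) r x X)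
  change φ.equiv x (chernFun hA a (p x) _) =
    chernFun hB b (q x) _ ⊗ₜ[ℂ] c (r x) + b (q x) ⊗ₜ[ℂ] chernFun hC c (r x) _
  rw [dA, dB, dC, map_smul, key.self_of_nhds, eq_coord_smul_tmul mB mC _ (c (r x)),
    eq_coord_smul_tmul mB mC (b (q x)), coord_smul mB, coord_smul mC, coord_frame mB,
    coord_frame mC, smul_smul, ← add_smul]
  congr 1
  simpa using main

/-- A unitary holomorphic isomorphism is compatible with the Chern connections. -/
theorem TensorIso₂.IsUnitary.isParallel {p : N → M₁} {A : HolLineBundle.{u, v₁, w₁} E M₁}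
    {q : N → M₂} {B : HolLineBundle.{u, v₂, w₂} E M₂}
    {r : N → M₃} {C : HolLineBundle.{u, v₃, w₃} E M₃}
    {t : N → M₄} {D : HolLineBundle.{u, v₄, w₄} E M₄} {φ : TensorIso₂ p A q B r C t D}
    {hA : HermitianMetric A} {hB : HermitianMetric B} {hC : HermitianMetric C}
    {hD : HermitianMetric D} (hφ : φ.IsUnitary hA hB hC hD)
    (hp : ContMDiff 𝓘(ℂ, E) 𝓘(ℂ, E) ω p) (hq : ContMDiff 𝓘(ℂ, E) 𝓘(ℂ, E) ω q)
    (hr : ContMDiff 𝓘(ℂ, E) 𝓘(ℂ, E) ω r) (ht : ContMDiff 𝓘(ℂ, E) 𝓘(ℂ, E) ω t) :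
    φ.IsParallel (chernConnection hA) (chernConnection hB) (chernConnection hC)
      (chernConnection hD) := by
  intro x a b c d ha hb hc hd habcd X
  have mA := A.mem_frameSet (p x)
  have mB := B.mem_frameSet (q x)
  have mC := C.mem_frameSet (r x)
  have mD := D.mem_frameSet (t x)
  have nA := hp.continuous.continuousAt (A.frameSet_mem_nhds (p x))
  have nB := hq.continuous.continuousAt (B.frameSet_mem_nhds (q x))
  have nC := hr.continuous.continuousAt (C.frameSet_mem_nhds (r x))
  have nD := ht.continuous.continuousAt (D.frameSet_mem_nhds (t x))
  obtain ⟨s, s', hs, hs', hss⟩ :=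
    φ.holomorphic x _ _ (holAlong_frame (hp x) mA) (holAlong_frame (hq x) mB)
  rw [holAlong_iff_coord (hr x) mC] at hs
  rw [holAlong_iff_coord (ht x) mD] at hs'
  -- Again the holomorphic matrix entry of `φ`, now between tensor products of frames on both sides.
  set k : N → ℂ := fun y ↦ C.coord (r x) (r y) (s y) * D.coord (t x) (t y) (s' y)
  have hk : ContMDiffAt 𝓘(ℂ, E) 𝓘(ℂ, ℂ) ω k x :=
    (contDiff_fst.mul contDiff_snd :
      ContDiff ℂ ω fun z : ℂ × ℂ ↦ z.1 * z.2).contMDiff.contMDiffAt.comp x (hs.prodMk_space hs')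
  have hk' := contMDiffAt_restrictScalars hk
  have key : ∀ᶠ y in 𝓝 x, φ.equiv y (A.frame (p x) (p y) ⊗ₜ[ℂ] B.frame (q x) (q y)) =
      k y • (C.frame (r x) (r y) ⊗ₜ[ℂ] D.frame (t x) (t y)) := by
    filter_upwards [hss, nC, nD] with y hy hyC hyD
    rw [hy, eq_coord_smul_tmul hyC hyD]
  have frame_ne : ∀ᶠ y in 𝓝 x,
      k y • (C.frame (r x) (r y) ⊗ₜ[ℂ] D.frame (t x) (t y)) ≠ 0 := by
    filter_upwards [key, nA, nB] with y hy hyA hyB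
    rw [← hy]
    exact (φ.equiv y).map_ne_zero_iff.2 (frame_tmul_frame_ne_zero hA hB hyA hyB)
  have h₁ : ∀ᶠ y in 𝓝 x, A.coord (p x) (p y) (a (p y)) * B.coord (q x) (q y) (b (q y)) * k y =
      C.coord (r x) (r y) (c (r y)) * D.coord (t x) (t y) (d (t y)) := by
    filter_upwards [key, frame_ne, habcd, nA, nB, nC, nD] with y hy hy0 hyabcd hyA hyB hyC hyD
    rw [eq_coord_smul_tmul hyA hyB (a _) (b _), map_smul, hy,
      eq_coord_smul_tmul hyC hyD (c _) (d _), smul_smul] at hyabcd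
    exact smul_left_injective ℂ (smul_ne_zero_iff.1 hy0).2 hyabcd
  have h₂ : ∀ᶠ y in 𝓝 x, hA.frameNorm (p x) (p y) * hB.frameNorm (q x) (q y) =
      starRingEnd ℂ (k y) * k y * (hC.frameNorm (r x) (r y) * hD.frameNorm (t x) (t y)) := by
    filter_upwards [key] with y hy
    have := hφ y (A.frame (p x) (p y) ⊗ₜ[ℂ] B.frame (q x) (q y))
      (A.frame (p x) (p y) ⊗ₜ[ℂ] B.frame (q x) (q y))
    rw [hy, tensorForm_smul_tmul_self, tensorForm_tmul] at this
    exact this.symm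
  have main := chern_product_formula (mdifferentiableAt_coord_comp (hp x) mA ha)
    (mdifferentiableAt_coord_comp (hq x) mB hb) (mdifferentiableAt_coord_comp (hr x) mC hc)
    (mdifferentiableAt_coord_comp (ht x) mD hd)
    (hk.mdifferentiableAt (by simp)) (hk'.mdifferentiableAt (by simp))
    (mdifferentiableAt_frameNorm_comp hA (hp x) mA) (mdifferentiableAt_frameNorm_comp hB (hq x) mB)
    (mdifferentiableAt_frameNorm_comp hC (hr x) mC) (mdifferentiableAt_frameNorm_comp hD (ht x) mD)
    (smul_ne_zero_iff.1 frame_ne.self_of_nhds).1 (frameNorm_ne_zero mA) (frameNorm_ne_zero mB)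
    (frameNorm_ne_zero mC) (frameNorm_ne_zero mD) h₁ h₂ X
  rw [← chernCoord_comp hA (hp x) mA ha, ← chernCoord_comp hB (hq x) mB hb,
    ← chernCoord_comp hC (hr x) mC hc, ← chernCoord_comp hD (ht x) mD hd] at main
  have dA := chernFun_apply (h := hA) ha (mfderiv 𝓘(ℝ, E) 𝓘(ℝ, E) p x X)
  have dB := chernFun_apply (h := hB) hb (mfderiv 𝓘(ℝ, E) 𝓘(ℝ, E) q x X)
  have dC := chernFun_apply (h := hC) hc (mfderiv 𝓘(ℝ, E) 𝓘(ℝ, E) r x X)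
  have dD := chernFun_apply (h := hD) hd (mfderiv 𝓘(ℝ, E) 𝓘(ℝ, E) t x X)
  change φ.equiv x (chernFun hA a (p x) _ ⊗ₜ[ℂ] b (q x) + a (p x) ⊗ₜ[ℂ] chernFun hB b (q x) _) =
    chernFun hC c (r x) _ ⊗ₜ[ℂ] d (t x) + c (r x) ⊗ₜ[ℂ] chernFun hD d (t x) _
  rw [dA, dB, dC, dD, eq_coord_smul_tmul mA mB _ (b (q x)), eq_coord_smul_tmul mA mB (a (p x)),
    eq_coord_smul_tmul mC mD _ (d (t x)), eq_coord_smul_tmul mC mD (c (r x)), ← add_smul,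
    ← add_smul, map_smul, key.self_of_nhds, coord_smul mA, coord_smul mB, coord_smul mC,
    coord_smul mD, coord_frame mA, coord_frame mB, coord_frame mC, coord_frame mD, smul_smul]
  congr 1
  simpa using main

end Parallel

/-! ### Holomorphy of inclusions and translations; assembling the connective structure. -/

section Cover

variable {E : Type u} [NormedAddCommGroup E] [NormedSpace ℂ E]
  {X : Type v} [TopologicalSpace X] [ChartedSpace E X] {I : Type v₂}

/-- Holomorphy is a local property and `W` carries the restricted charts, so it can be tested after
inclusion into `X`. -/
theorem contMDiff_into_opens {U W : Opens X} {f : U → W}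
    (hf : ContMDiff 𝓘(ℂ, E) 𝓘(ℂ, E) ω (fun x ↦ (f x : X))) :
    ContMDiff 𝓘(ℂ, E) 𝓘(ℂ, E) ω f :=
  fun x ↦ (ChartedSpace.liftPropWithinAt_subtypeVal_comp_iff f Set.univ x).1 (hf x)

variable {G : Type v₁} [Group G] [MulAction G X] [MulAction G I]

theorem contMDiff_translate (hG : ∀ g : G, ContMDiff 𝓘(ℂ, E) 𝓘(ℂ, E) ω (fun x : X ↦ g • x))
    (𝒰 : InvariantCover G X I) (g : G) (a : I) :
    ContMDiff 𝓘(ℂ, E) 𝓘(ℂ, E) ω (translate 𝒰 g a) :=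
  contMDiff_into_opens ((hG g⁻¹).comp contMDiff_subtype_val)

theorem contMDiff_translate₂ (hG : ∀ g : G, ContMDiff 𝓘(ℂ, E) 𝓘(ℂ, E) ω (fun x : X ↦ g • x))
    (𝒰 : InvariantCover G X I) (g : G) (a b : I) :
    ContMDiff 𝓘(ℂ, E) 𝓘(ℂ, E) ω (translate₂ 𝒰 g a b) :=
  contMDiff_into_opens ((hG g⁻¹).comp contMDiff_subtype_val)

/-- The connective structure given by the Chern connections. -/
def chernConnectiveStructure [IsManifold 𝓘(ℂ, E) ω X]
    (hG : ∀ g : G, ContMDiff 𝓘(ℂ, E) 𝓘(ℂ, E) ω (fun x : X ↦ g • x))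
    {𝒰 : InvariantCover G X I} {𝒢 : EquivariantGerbe.{u, v, w} E 𝒰}
    (h : EquivariantHermitianStructure 𝒢) : ConnectiveStructure 𝒢 where
  conn a b := chernConnection (h.metric a b)
  connG g a := chernConnection (h.metricG g a)
  parallel₀ a b c := (h.unitary₀ a b c).isParallel (contMDiff_into_opens contMDiff_subtype_val)
    (contMDiff_into_opens contMDiff_subtype_val) (contMDiff_into_opens contMDiff_subtype_val)
  parallel₁ g a b := (h.unitary₁ g a b).isParallel (contMDiff_translate₂ hG 𝒰 g a b)
    (contMDiff_into_opens contMDiff_subtype_val) (contMDiff_into_opens contMDiff_subtype_val)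
    contMDiff_id
  parallel₂ g₁ g₂ a := (h.unitary₂ g₁ g₂ a).isParallel contMDiff_id contMDiff_id
    (contMDiff_translate hG 𝒰 g₁ a)

end Cover

end HermGerbe

/-! ### Existence and uniqueness of the compatible connective structure. -/

theorem mainTheorem9 {E : Type u} [NormedAddCommGroup E] [NormedSpace ℂ E] [FiniteDimensional ℂ E]
    {X : Type v} [TopologicalSpace X] [ChartedSpace E X] [IsManifold 𝓘(ℂ, E) ω X]
    {G : Type v₁} [Group G] [MulAction G X]
    (hG : ∀ g : G, ContMDiff 𝓘(ℂ, E) 𝓘(ℂ, E) ω (fun x : X ↦ g • x))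
    {I : Type v₂} [MulAction G I] (𝒰 : HermGerbe.InvariantCover G X I)
    (𝒢 : HermGerbe.EquivariantGerbe.{u, v, w} E 𝒰)
    (h : HermGerbe.EquivariantHermitianStructure 𝒢) :
    ∃! D : HermGerbe.ConnectiveStructure 𝒢, D.IsCompatible h := by
  refine ⟨HermGerbe.chernConnectiveStructure hG h,
    ⟨fun _ _ ↦ HermGerbe.preservesMetric_chernConnection,
      fun _ _ ↦ HermGerbe.preservesMetric_chernConnection,
      fun _ _ ↦ HermGerbe.isHolCompatible_chernConnection,
      fun _ _ ↦ HermGerbe.isHolCompatible_chernConnection⟩, fun D hD ↦ ?_⟩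
  have h₁ : D.conn = (HermGerbe.chernConnectiveStructure hG h).conn := by
    funext a b
    exact HermGerbe.Connection.eq_chernConnection (hD.preservesMetric a b) (hD.holCompatible a b)
  have h₂ : D.connG = (HermGerbe.chernConnectiveStructure hG h).connG := by
    funext g a
    exact HermGerbe.Connection.eq_chernConnection (hD.preservesMetricG g a) (hD.holCompatibleG g a)
  -- The remaining fields are propositions, so equality of the two families of connections suffices.
  obtain ⟨conn, connG, _, _, _⟩ := D
  subst h₁ h₂
  rfl
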